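/- Let $d,m\ge 1$ be integers and let $Q=(q_{kl}):\mathbb R^d\to\mathbb R^{d\times d}$, $F_{ij},C_{ij}:\mathbb R^d\to\mathbb R^d$ and $V=(v_{ij}):\mathbb R^d\to\mathbb R^{m\times m}$ ($1\le i,j\le m$) satisfy the following hypotheses. (i) $Q$ is Lebesgue measurable, $Q(x)$ is symmetric for every $x$, and there are $\eta_1,\eta_2>0$ with $\eta_1|\xi|^2\le\langle Q(x)\xi,\xi\rangle\le\eta_2|\xi|^2$ for all $x,\xi\in\mathbb R^d$. (ii) $F_{ij},C_{ij}\in L^\infty(\mathbb R^d,\mathbb R^d)$ for all $i,j\in\{1,\dots,m\}$. (iii) $v_{ij}\in L^1_{\mathrm{loc}}(\mathbb R^d)$ for all $i,j\in\{1,\dots,m\}$, and there is $M>0$ with $|\mathrm{Im}\langle V(x)\xi,\xi\rangle|\le M\,\mathrm{Re}\langle V(x)\xi,\xi\rangle$ for all $x\in\mathbb R^d$, $\xi\in\mathbb C^m$. Here $\langle\xi,\zeta\rangle=\sum_i\xi_i\overline{\zeta_i}$ and $y\cdot z=\sum_k y_kz_k$. Consider the differential expression $$(\mathcal Lf)_i=\mathrm{div}(Q\nabla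 f_i)-\sum_{j=1}^m F_{ij}\cdot\nabla f_j+\sum_{j=1}^m\mathrm{div}(f_jC_{ij})-\sum_{j=1}^m v_{ij}f_j,\qquad 1\le i\le m,$$ and the sesquilinear form $$a(f,g)=\sum_i\int\langle Q\nabla f_i,\nabla g_i\rangle\,dx+\sum_{i,j}\int(F_{ij}\cdot\nabla f_j)\overline{g_i}\,dx+\sum_{i,j}\int f_j\langle C_{ij},\nabla g_i\rangle\,dx+\int\langle Vf,g\rangle\,dx$$ with domain $D(a)=\{f\in H^1(\mathbb R^d,\mathbb C^m):\int\langle V_sf,f\rangle\,dx<\infty\}$, where all integrals are over $\mathbb R^d$ and $V_s=\frac12(V+V^*)$. Then there is a linear operator $L$ in $L^2(\mathbb R^d,\mathbb C^m)$ such that $-L$ is the operator associated with $a$; that is, $f\in D(L)$ and $Lf=g$ if and only if $f\in D(a)$ and $a(f,h)=-\langle g,h\rangle_{2}$ for all $h\in D(a)$. This $L$ is a realization of $\mathcal L$: for every $f\in D(L)$ one has $Vf\in L^1_{\mathrm{loc}}(\mathbb R^d,\mathbb C^m)$ and $\mathcal Lf=Lf$ in the sense of distributions. Moreover, $L$ is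 the generator of an analytic $C_0$-semigroup $\{S_2(t)\}_{t\ge0}$ on $L^2(\mathbb R^d,\mathbb C^m)$, and there exists $\omega\ge0$ such that $\|S_2(t)\|\le e^{\omega t}$ for every $t\ge0$. (A $C_0$-semigroup $\{S(t)\}_{t\ge 0}$ is analytic if for some $\delta\in(0,\pi/2]$ it extends to a family $\{T(z)\}$ of bounded operators that is holomorphic in $z\in\Sigma_\delta=\{z\neq0:|\arg z|<\delta\}$, satisfies $T(z+w)=T(z)T(w)$ on $\Sigma_\delta$, and satisfies $T(z)x\to x$ as $z\to0$ in $\Sigma_{\delta'}$, for every $x$ and every $0<\delta'<\delta$.) -/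

import Mathlib

noncomputable section

namespace EllipticSystem

open MeasureTheory Filter Topology
open scoped ContDiff ComplexConjugate

/-- The domain `ℝ^d`, with its Euclidean norm and Lebesgue measure. -/
abbrev Rd (d : ℕ) : Type := EuclideanSpace ℝ (Fin d)

/-- The Hilbert space `L²(ℝ^d, ℂ^m)`. -/
abbrev L2 (d m : ℕ) : Type :=
  Lp (EuclideanSpace ℂ (Fin m)) 2 (volume : Measure (Rd d))

/-- The `k`-th unit vector of `ℝ^d`. -/
abbrev unitVec {d : ℕ} (k : Fin d) : Rd d := EuclideanSpace.single k (1 : ℝ)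

/-- The coefficients `Q`, `F`, `C`, `V` of the differential expression
`𝓛 f = div (Q ∇f) - F · ∇f + div (C f) - V f`. -/
structure Coefficients (d m : ℕ) where
  /-- the diffusion matrix `Q = (q_{kl})` -/
  Q : Rd d → Matrix (Fin d) (Fin d) ℝ
  /-- the drift vector fields `F_{ij}` -/
  F : Fin m → Fin m → Rd d → Rd d
  /-- the drift vector fields `C_{ij}` -/
  C : Fin m → Fin m → Rd d → Rd d
  /-- the potential matrix `V = (v_{ij})` -/
  V : Rd d → Matrix (Fin m) (Fin m) ℝ

/-- `⟨A ξ, ζ⟩ = ∑ i, (A ξ)_i * conj ζ_i` for a real matrix `A` and complex vectors `ξ`, `ζ`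
(linear in `ξ`, conjugate linear in `ζ`). -/
def pairing {n : ℕ} (A : Matrix (Fin n) (Fin n) ℝ) (ξ ζ : Fin n → ℂ) : ℂ :=
  ∑ i, (∑ j, (A i j : ℂ) * ξ j) * conj (ζ i)

/-- The symmetric part `V_s(x) = (V(x) + V(x)^*) / 2` of the (real) potential matrix. -/
def Coefficients.Vs {d m : ℕ} (c : Coefficients d m) (x : Rd d) : Matrix (Fin m) (Fin m) ℝ :=
  (1 / 2 : ℝ) • (c.V x + (c.V x).transpose)

/-- The standing hypotheses on the coefficients. -/
structure Hypotheses {d m : ℕ} (c : Coefficients d m) : Prop where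
  /-- `Q` is Lebesgue measurable. -/
  measurable_Q : ∀ k l, AEMeasurable (fun x => c.Q x k l) volume
  /-- `Q(x)` is symmetric. -/
  symm_Q : ∀ x, (c.Q x).IsSymm
  /-- `η₁ |ξ|² ≤ ⟨Q(x) ξ, ξ⟩ ≤ η₂ |ξ|²`. -/
  elliptic_Q : ∃ η₁ η₂ : ℝ, 0 < η₁ ∧ 0 < η₂ ∧ ∀ x ξ : Rd d,
    η₁ * ‖ξ‖ ^ 2 ≤ ∑ k, (∑ l, c.Q x k l * ξ l) * ξ k ∧
      ∑ k, (∑ l, c.Q x k l * ξ l) * ξ k ≤ η₂ * ‖ξ‖ ^ 2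
  /-- `F_{ij} ∈ L^∞(ℝ^d, ℝ^d)`. -/
  bounded_F : ∀ i j, MemLp (c.F i j) ⊤ volume
  /-- `C_{ij} ∈ L^∞(ℝ^d, ℝ^d)`. -/
  bounded_C : ∀ i j, MemLp (c.C i j) ⊤ volume
  /-- `v_{ij} ∈ L¹_loc(ℝ^d)`. -/
  locallyIntegrable_V : ∀ i j, LocallyIntegrable (fun x => c.V x i j) volume
  /-- `|Im ⟨V(x) ξ, ξ⟩| ≤ M Re ⟨V(x) ξ, ξ⟩`. -/
  sectorial_V : ∃ M : ℝ, 0 < M ∧ ∀ (x : Rd d) (ξ : Fin m → ℂ),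
    |(pairing (c.V x) ξ ξ).im| ≤ M * (pairing (c.V x) ξ ξ).re

/-- `g` is the distributional derivative `∂_k f`, for `f, g ∈ L²(ℝ^d, ℂ^m)`. -/
def HasWeakDeriv {d m : ℕ} (k : Fin d) (f g : L2 d m) : Prop :=
  ∀ φ : Rd d → ℝ, ContDiff ℝ ∞ φ → HasCompactSupport φ →
    ∫ x, (fderiv ℝ φ x (unitVec k)) • f x = -∫ x, φ x • g x

/-- The distributional derivative is unique. -/
theorem HasWeakDeriv.unique {d m : ℕ} {k : Fin d} {f g h : L2 d m}
    (hg : HasWeakDeriv k f g) (hh : HasWeakDeriv k f h) : g = h := by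
  have hgl : LocallyIntegrable (fun x => g x) (volume : Measure (Rd d)) :=
    (Lp.memLp g).locallyIntegrable (by norm_num)
  have hhl : LocallyIntegrable (fun x => h x) (volume : Measure (Rd d)) :=
    (Lp.memLp h).locallyIntegrable (by norm_num)
  refine Lp.ext ?_
  refine ae_eq_of_integral_contDiff_smul_eq hgl hhl fun φ hφ hc => ?_
  exact neg_injective ((hg φ hφ hc).symm.trans (hh φ hφ hc))

/-- `f ∈ H¹(ℝ^d, ℂ^m)`. -/
def MemH1 {d m : ℕ} (f : L2 d m) : Prop := ∀ k : Fin d, ∃ g : L2 d m, HasWeakDeriv k f g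

open Classical in
/-- The distributional derivative `∂_k f`, if it is in `L²(ℝ^d, ℂ^m)` (and `0` otherwise). -/
def weakDeriv {d m : ℕ} (k : Fin d) (f : L2 d m) : L2 d m :=
  if h : ∃ g : L2 d m, HasWeakDeriv k f g then h.choose else 0

theorem hasWeakDeriv_iff {d m : ℕ} {k : Fin d} {f g : L2 d m}
    (hf : ∃ g : L2 d m, HasWeakDeriv k f g) : HasWeakDeriv k f g ↔ weakDeriv k f = g := by
  have h : HasWeakDeriv k f (weakDeriv k f) := by
    rw [weakDeriv, dif_pos hf]; exact hf.choose_spec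
  exact ⟨fun hg => h.unique hg, fun e => e ▸ h⟩

/-- The domain `D(a) = {f ∈ H¹(ℝ^d, ℂ^m) : ∫ ⟨V_s f, f⟩ dx < ∞}` of the form. -/
def MemFormDomain {d m : ℕ} (c : Coefficients d m) (f : L2 d m) : Prop :=
  MemH1 f ∧ Integrable (fun x => pairing (c.Vs x) (f x) (f x)) volume

/-- The integral expression
`∑ i, ∫ ⟨Q ∇f_i, ∇g_i⟩ + ∑ i j, ∫ (F_{ij} · ∇f_j) conj g_i + ∑ i j, ∫ f_j ⟨C_{ij}, ∇g_i⟩ + ∫ ⟨V f, g⟩`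
for functions `f`, `g` whose partial derivatives are the functions `Df k`, `Dg k`. -/
def formIntegral {d m : ℕ} (c : Coefficients d m)
    (f : Rd d → EuclideanSpace ℂ (Fin m)) (Df : Fin d → Rd d → EuclideanSpace ℂ (Fin m))
    (g : Rd d → EuclideanSpace ℂ (Fin m)) (Dg : Fin d → Rd d → EuclideanSpace ℂ (Fin m)) : ℂ :=
  (∑ i, ∫ x, pairing (c.Q x) (fun k => Df k x i) (fun k => Dg k x i))
  + (∑ i, ∑ j, ∫ x, (∑ k, (c.F i j x k : ℂ) * Df k x j) * conj (g x i))
  + (∑ i, ∑ j, ∫ x, f x j * ∑ k, (c.C i j x k : ℂ) * conj (Dg k x i))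
  + ∫ x, pairing (c.V x) (f x) (g x)

/-- The sesquilinear form `a(f, g)`, for `f, g ∈ D(a)`. -/
def form {d m : ℕ} (c : Coefficients d m) (f g : L2 d m) : ℂ :=
  formIntegral c f (fun k => weakDeriv k f) g (fun k => weakDeriv k g)

/-- `-L` is the operator associated with the form `a`: `f ∈ D(L)` and `L f = g` if and only if
`f ∈ D(a)` and `a(f, h) = -⟨g, h⟩` for all `h ∈ D(a)`
(the inner product of `L2` is conjugate linear in its first argument). -/
def IsFormRealization {d m : ℕ} (c : Coefficients d m) (L : L2 d m →ₗ.[ℂ] L2 d m) : Prop :=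
  ∀ f g : L2 d m, (f, g) ∈ L.graph ↔
    MemFormDomain c f ∧ ∀ h : L2 d m, MemFormDomain c h → form c f h = -inner ℂ h g

/-- `f ∈ H¹(ℝ^d, ℂ^m)`, `V f ∈ L¹_loc`, and `𝓛 f = g` in the sense of distributions. -/
def EqInDistributions {d m : ℕ} (c : Coefficients d m) (f g : L2 d m) : Prop :=
  MemH1 f ∧
  (∀ i, LocallyIntegrable (fun x => ∑ j, (c.V x i j : ℂ) * f x j) volume) ∧
  ∀ φ : Rd d → EuclideanSpace ℂ (Fin m), ContDiff ℝ ∞ φ → HasCompactSupport φ →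
    -formIntegral c f (fun k => weakDeriv k f) φ (fun k x => fderiv ℝ φ x (unitVec k))
      = ∫ x, ∑ i, g x i * conj (φ x i)

section Semigroups

variable {X : Type*} [NormedAddCommGroup X] [NormedSpace ℂ X]

/-- `(S(t))_{t ≥ 0}` is a `C₀`-semigroup of bounded operators (values at `t < 0` are irrelevant). -/
structure IsC0Semigroup (S : ℝ → X →L[ℂ] X) : Prop where
  zero : S 0 = ContinuousLinearMap.id ℂ X
  add : ∀ s t : ℝ, 0 ≤ s → 0 ≤ t → S (s + t) = (S s).comp (S t)
  tendsto : ∀ x : X, Tendsto (fun t => S t x) (𝓝[>] 0) (𝓝 x)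

/-- The open sector `{z ≠ 0 : |arg z| < δ}`. -/
def sector (δ : ℝ) : Set ℂ := {z | z ≠ 0 ∧ |z.arg| < δ}

/-- `(S(t))_{t ≥ 0}` is an analytic `C₀`-semigroup: it extends to a holomorphic semigroup on some
sector, strongly continuous at `0` on every smaller sector. -/
def IsAnalyticC0Semigroup (S : ℝ → X →L[ℂ] X) : Prop :=
  IsC0Semigroup S ∧
  ∃ δ : ℝ, 0 < δ ∧ δ ≤ Real.pi / 2 ∧ ∃ T : ℂ → X →L[ℂ] X,
    (∀ t : ℝ, 0 < t → T t = S t) ∧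
    DifferentiableOn ℂ T (sector δ) ∧
    (∀ z ∈ sector δ, ∀ w ∈ sector δ, T (z + w) = (T z).comp (T w)) ∧
    ∀ δ' : ℝ, 0 < δ' → δ' < δ → ∀ x : X, Tendsto (fun z => T z x) (𝓝[sector δ'] 0) (𝓝 x)

/-- `L` is the generator of `(S(t))_{t ≥ 0}`: `x ∈ D(L)` and `L x = y` if and only if
`(S(t) x - x) / t → y` as `t → 0+`. -/
def IsGenerator (L : X →ₗ.[ℂ] X) (S : ℝ → X →L[ℂ] X) : Prop :=
  ∀ x y : X, (x, y) ∈ L.graph ↔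
    Tendsto (fun t : ℝ => ((t⁻¹ : ℝ) : ℂ) • (S t x - x)) (𝓝[>] 0) (𝓝 y)

end Semigroups

end EllipticSystem

end

/-!
The form `a` is the sectorial form `∑ i, ∫ ⟨Q ∇f_i, ∇g_i⟩ + ∫ ⟨V f, g⟩` perturbed by first order
terms `a₁` which, the fields `F_{ij}`, `C_{ij}` being bounded, satisfy
`|a₁(f, f)| ≤ ε ‖∇f‖² + C_ε ‖f‖²` and are therefore absorbed by ellipticity. Hence, for a large
constant `κ`, the form `a + κ` is sectorial, `|Im (a + κ)(f, f)| ≤ M Re (a + κ)(f, f)`, and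
`Re (a + κ)` is equivalent to the square `‖f‖² + ‖∇f‖² + ∫ ⟨V_s f, f⟩` of the form norm
(`exists_shiftedForm_bounds`). The form domain is complete for this norm because weak
differentiation is closed and, by Fatou's lemma, the potential part is lower semicontinuous
(`exists_tendsto_energy`). The Lax–Milgram theorem
(`exists_forall_form_add_inner_eq`) then shows that `s + (κ - L)` is onto for every `s > 0`, so that
`B = κ - L` is an `m`-sectorial operator (`exists_isMSectorial_shiftedGraph`).

Such an operator `B` generates a holomorphic contraction semigroup. No contour integral is needed:
the Yosida approximations `-s B (s + B)⁻¹` of `-B` have their numerical range in the same sector as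
`-B`, so the exponentials `exp (-z s B (s + B)⁻¹)` are contractions for all `z` in the polar cone
`M |Im z| ≤ Re z`, not only for `z ≥ 0`. They commute, hence by Duhamel's formula they converge
strongly, uniformly for bounded `z`, as `s → ∞`. The limit inherits the semigroup law, strong
continuity on the closed cone and strong holomorphy in its interior; a bounded strongly holomorphic
function is holomorphic in operator norm (`differentiableOn_clm_of_forall_apply`). Its generator is
`-B`, since it extends `-B`, is dissipative, and `1 + B` is onto. Rescaling by `exp (κ t)` gives the
semigroup generated by `L` (`exists_isAnalyticC0Semigroup`).

Test functions belong to the form domain because `V` is locally integrable. They are dense, which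
makes the associated operator single-valued; and testing the form identity with them shows that
`L f` is `𝓛 f` in the sense of distributions (`eqInDistributions_of_form_eq`).
-/

noncomputable section

namespace EllipticSystem

open MeasureTheory Filter Topology
open scoped ComplexConjugate

/-! ### Exponentials of bounded dissipative operators -/

section Exponentials

variable {H : Type*} [NormedAddCommGroup H] [InnerProductSpace ℂ H] [CompleteSpace H]

/-- Restriction of a complex derivative to the real line. -/
theorem _root_.HasDerivAt.comp_ofReal_vector {F : Type*} [NormedAddCommGroup F] [NormedSpace ℂ F]
    {f : ℂ → F} {f' : F} {t : ℝ} (h : HasDerivAt f f' (t : ℂ)) :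
    HasDerivAt (fun s : ℝ => f s) f' t := by
  have := h.scomp t Complex.ofRealCLM.hasDerivAt
  simpa [Function.comp_def] using this

theorem hasDerivAt_exp_smul (C : H →L[ℂ] H) (z : ℂ) :
    HasDerivAt (fun w : ℂ => NormedSpace.exp (w • C)) (NormedSpace.exp (z • C) * C) z :=
  hasDerivAt_exp_smul_const (𝕂 := ℂ) C z

theorem commute_exp_smul {C D : H →L[ℂ] H} (h : Commute C D) (z : ℂ) :
    Commute C (NormedSpace.exp (z • D)) := by
  let _ : NormedAlgebra ℚ (H →L[ℂ] H) := NormedAlgebra.restrictScalars ℚ ℂ (H →L[ℂ] H)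
  exact (h.smul_right z).exp_right

theorem exp_add_smul (C : H →L[ℂ] H) (z w : ℂ) :
    NormedSpace.exp ((z + w) • C) = NormedSpace.exp (z • C) * NormedSpace.exp (w • C) := by
  let _ : NormedAlgebra ℚ (H →L[ℂ] H) := NormedAlgebra.restrictScalars ℚ ℂ (H →L[ℂ] H)
  rw [add_smul]
  exact NormedSpace.exp_add_of_commute (((Commute.refl C).smul_left z).smul_right w)

/-- A bounded dissipative operator generates contractions: `t ↦ ‖exp (t C) x‖²` is antitone. -/
theorem norm_exp_le_one_of_dissipative {C : H →L[ℂ] H}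
    (hC : ∀ x, (inner ℂ x (C x)).re ≤ 0) : ‖NormedSpace.exp C‖ ≤ 1 := by
  refine ContinuousLinearMap.opNorm_le_bound _ zero_le_one fun x => ?_
  let _ : InnerProductSpace ℝ H := InnerProductSpace.rclikeToReal ℂ H
  have hder : ∀ t : ℝ, HasDerivAt (fun s : ℝ => NormedSpace.exp ((s : ℂ) • C) x)
      (C (NormedSpace.exp ((t : ℂ) • C) x)) t := fun t => by
    have h := ((hasDerivAt_exp_smul C t).clm_apply (hasDerivAt_const (t : ℂ) x)).comp_ofReal_vector
    rw [← (commute_exp_smul (Commute.refl C) t).eq] at h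
    simpa using h
  have hanti : Antitone fun s : ℝ => ‖NormedSpace.exp ((s : ℂ) • C) x‖ ^ 2 := by
    refine antitone_of_hasDerivAt_nonpos (fun t => (hder t).norm_sq) fun t => ?_
    have := hC (NormedSpace.exp ((t : ℂ) • C) x)
    rw [real_inner_eq_re_inner ℂ]
    simp only [RCLike.re_to_complex, Pi.zero_apply]
    linarith
  have h := hanti zero_le_one
  simp only [Complex.ofReal_one, one_smul, Complex.ofReal_zero, zero_smul,
    NormedSpace.exp_zero, one_apply_eq_self] at h
  rw [one_mul]
  exact le_of_sq_le_sq h (norm_nonneg _)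

/-- Two commuting families of contractions `exp (t C)`, `exp (t D)` differ by at most the
difference of their generators: differentiate `t ↦ exp (t C) exp ((1 - t) D) x`. -/
theorem norm_exp_sub_exp_le {C D : H →L[ℂ] H} (h : Commute C D)
    (hC : ∀ t : ℝ, 0 ≤ t → ‖NormedSpace.exp ((t : ℂ) • C)‖ ≤ 1)
    (hD : ∀ t : ℝ, 0 ≤ t → ‖NormedSpace.exp ((t : ℂ) • D)‖ ≤ 1) (x : H) :
    ‖NormedSpace.exp C x - NormedSpace.exp D x‖ ≤ ‖C x - D x‖ := by
  have hder : ∀ t : ℝ, HasDerivAt (fun s : ℝ =>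
      NormedSpace.exp ((s : ℂ) • C) (NormedSpace.exp (((1 - s : ℝ) : ℂ) • D) x))
      (NormedSpace.exp ((t : ℂ) • C) (NormedSpace.exp (((1 - t : ℝ) : ℂ) • D) (C x - D x))) t := by
    intro t
    have h1 : HasDerivAt (fun w : ℂ => NormedSpace.exp ((1 - w) • D) x)
        (-(NormedSpace.exp ((1 - t : ℂ) • D) (D x))) (t : ℂ) := by
      have := (hasDerivAt_exp_smul D (1 - t)).scomp (t : ℂ) ((hasDerivAt_id (t : ℂ)).const_sub 1)
      simpa using this.clm_apply (hasDerivAt_const (t : ℂ) x)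
    have h2 := ((hasDerivAt_exp_smul C t).clm_apply h1).comp_ofReal_vector
    simp only [Complex.ofReal_sub, Complex.ofReal_one]
    convert h2 using 1
    have h3 : NormedSpace.exp ((1 - t : ℂ) • D) (C x) = C (NormedSpace.exp ((1 - t : ℂ) • D) x) :=
      (congrArg (fun T : H →L[ℂ] H => T x) (commute_exp_smul h (1 - t : ℂ)).eq).symm
    simp only [map_sub, map_neg, mul_apply_eq_comp, h3]
    abel
  have := norm_image_sub_le_of_norm_deriv_le_segment_01' (C := ‖C x - D x‖)
    (fun t _ => (hder t).hasDerivWithinAt) fun t ht => by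
      refine ((NormedSpace.exp ((t : ℂ) • C)).le_of_opNorm_le (hC t ht.1) _).trans ?_
      rw [one_mul]
      refine ((NormedSpace.exp (((1 - t : ℝ) : ℂ) • D)).le_of_opNorm_le
        (hD _ (by linarith [ht.2])) _).trans ?_
      rw [one_mul]
  simpa using this

/-- First order Taylor estimate for a bounded operator `C`. -/
theorem norm_exp_sub_sub_le {C : H →L[ℂ] H} (x : H) {ε : ℝ}
    (hC : ∀ t : ℝ, 0 ≤ t → t ≤ 1 → ‖NormedSpace.exp ((t : ℂ) • C) (C x) - C x‖ ≤ ε) :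
    ‖NormedSpace.exp C x - x - C x‖ ≤ ε := by
  have hder : ∀ t : ℝ, HasDerivAt (fun s : ℝ => NormedSpace.exp ((s : ℂ) • C) x - s • C x)
      (NormedSpace.exp ((t : ℂ) • C) (C x) - C x) t := by
    intro t
    have h1 := ((hasDerivAt_exp_smul C t).clm_apply (hasDerivAt_const (t : ℂ) x)).comp_ofReal_vector
    have h2 := (hasDerivAt_id t).smul_const (C x)
    simpa using h1.fun_sub h2
  have := norm_image_sub_le_of_norm_deriv_le_segment_01' (C := ε)
    (fun t _ => (hder t).hasDerivWithinAt) fun t ht => hC t ht.1 ht.2.le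
  have e : NormedSpace.exp C x - x - C x = NormedSpace.exp C x - C x - x := by abel
  rw [e]
  simpa using this

end Exponentials

/-! ### Strongly holomorphic operator-valued functions -/

section Holomorphy

variable {E F : Type*} [NormedAddCommGroup E] [NormedSpace ℂ E] [NormedAddCommGroup F]
  [NormedSpace ℂ F]

/-- A function on a disc around `c` that is bounded by `K` is approximated by its linearisation at
`c` with an error controlled by `K` only (Schwarz's lemma, twice). -/
theorem norm_sub_sub_deriv_le [CompleteSpace F] {f : ℂ → F} {c : ℂ} {r K : ℝ} (hr : 0 < r)
    (hd : DifferentiableOn ℂ f (Metric.ball c r)) (hK : ∀ z ∈ Metric.ball c r, ‖f z‖ ≤ K)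
    {z : ℂ} (hz : z ∈ Metric.ball c r) :
    ‖deriv f c‖ ≤ 2 * K / r ∧
      ‖f z - f c - (z - c) • deriv f c‖ ≤ 4 * K / r ^ 2 * ‖z - c‖ ^ 2 := by
  have hc : c ∈ Metric.ball c r := Metric.mem_ball_self hr
  have hnhds : Metric.ball c r ∈ 𝓝 c := Metric.ball_mem_nhds c hr
  have h1 : ∀ w ∈ Metric.ball c r, ‖dslope f c w‖ ≤ 2 * K / r := fun w hw => by
    refine Complex.norm_dslope_le_div_of_mapsTo_ball hd (fun v hv => ?_) hw
    rw [Metric.mem_closedBall, dist_eq_norm]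
    linarith [norm_sub_le (f v) (f c), hK v hv, hK c hc]
  have hd1 : DifferentiableOn ℂ (dslope f c) (Metric.ball c r) :=
    (Complex.differentiableOn_dslope hnhds).2 hd
  have h2 : ‖dslope (dslope f c) c z‖ ≤ (4 * K / r) / r := by
    refine Complex.norm_dslope_le_div_of_mapsTo_ball hd1 (fun v hv => ?_) hz
    rw [Metric.mem_closedBall, dist_eq_norm]
    have := norm_sub_le (dslope f c v) (dslope f c c)
    have e : 4 * K / r = 2 * K / r + 2 * K / r := by ring
    linarith [h1 v hv, h1 c hc]
  refine ⟨by simpa using h1 c hc, ?_⟩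
  have e : f z - f c - (z - c) • deriv f c
      = (z - c) • ((z - c) • dslope (dslope f c) c z) := by
    rw [sub_smul_dslope, smul_sub, sub_smul_dslope, dslope_same]
  rw [e, norm_smul, norm_smul]
  have e2 : 4 * K / r ^ 2 = (4 * K / r) / r := by field_simp
  rw [e2]
  nlinarith [mul_le_mul_of_nonneg_left h2 (sq_nonneg ‖z - c‖)]

/-- A bounded, strongly holomorphic operator-valued function is holomorphic in operator norm. -/
theorem differentiableOn_clm_of_forall_apply [CompleteSpace F] {T : ℂ → E →L[ℂ] F} {U : Set ℂ}
    {K : ℝ} (hU : IsOpen U) (hK : ∀ z ∈ U, ‖T z‖ ≤ K)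
    (hT : ∀ x, DifferentiableOn ℂ (fun z => T z x) U) : DifferentiableOn ℂ T U := by
  intro c hc
  refine DifferentiableAt.differentiableWithinAt ?_
  obtain ⟨r, hr, hball⟩ := Metric.isOpen_iff.1 hU c hc
  have hdc : ∀ x, DifferentiableAt ℂ (fun z => T z x) c := fun x =>
    (hT x).differentiableAt (hU.mem_nhds hc)
  have hb : ∀ x, ∀ z ∈ Metric.ball c r, ‖T z x‖ ≤ K * ‖x‖ := fun x z hz =>
    (T z).le_of_opNorm_le (hK z (hball hz)) x
  let D₀ : E →ₗ[ℂ] F :=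
    { toFun := fun x => deriv (fun z => T z x) c
      map_add' := fun x y => by
        simp only [map_add]
        exact deriv_fun_add (hdc x) (hdc y)
      map_smul' := fun a x => by
        simp only [map_smul, RingHom.id_apply]
        exact deriv_fun_const_smul a (hdc x) }
  let D : E →L[ℂ] F := D₀.mkContinuous (2 * K / r) fun x => by
    have := (norm_sub_sub_deriv_le hr ((hT x).mono hball) (hb x) (Metric.mem_ball_self hr)).1
    calc ‖D₀ x‖ ≤ 2 * (K * ‖x‖) / r := this
      _ = _ := by ring
  refine HasDerivAt.differentiableAt (f' := D) ?_
  rw [hasDerivAt_iff_isLittleO]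
  refine Asymptotics.IsBigO.trans_isLittleO (g := fun z => ‖z - c‖ ^ 2) ?_ ?_
  · refine Asymptotics.IsBigO.of_bound (4 * K / r ^ 2) ?_
    filter_upwards [Metric.ball_mem_nhds c hr] with z hz
    have hK0 : 0 ≤ K := (norm_nonneg _).trans (hK c hc)
    rw [Real.norm_of_nonneg (by positivity)]
    refine ContinuousLinearMap.opNorm_le_bound _ (by positivity) fun x => ?_
    have := (norm_sub_sub_deriv_le hr ((hT x).mono hball) (hb x) hz).2
    calc _ ≤ 4 * (K * ‖x‖) / r ^ 2 * ‖z - c‖ ^ 2 := this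
      _ = _ := by ring
  · have h : (fun z : ℂ => ‖z - c‖ ^ 2) =o[𝓝 c] fun z => ‖z - c‖ ^ 1 := by
      have := (Asymptotics.isLittleO_norm_pow_norm_pow (E' := ℂ) (show 1 < 2 by norm_num))
      have ht : Tendsto (fun z : ℂ => z - c) (𝓝 c) (𝓝 0) := by
        simpa using (continuous_sub_right c).tendsto c
      exact this.comp_tendsto ht
    simpa using h

end Holomorphy

/-! ### The contraction semigroup of an `m`-sectorial operator -/

section Generation

/-- The closed cone of all `z` with `M |Im z| ≤ Re z`, polar to the sector
`|Im w| ≤ M Re w` in the sense that `Re (z w) ≥ 0`. -/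
def cone (M : ℝ) : Set ℂ := {z | M * |z.im| ≤ z.re}

theorem add_mem_cone {M : ℝ} (hM : 0 ≤ M) {z w : ℂ} (hz : z ∈ cone M) (hw : w ∈ cone M) :
    z + w ∈ cone M := by
  simp only [cone, Set.mem_ofPred_eq, Complex.add_im, Complex.add_re] at *
  nlinarith [abs_add_le z.im w.im]

theorem ofReal_mul_mem_cone {M t : ℝ} (ht : 0 ≤ t) {z : ℂ} (hz : z ∈ cone M) :
    (t : ℂ) * z ∈ cone M := by
  simp only [cone, Set.mem_ofPred_eq, Complex.re_ofReal_mul, Complex.im_ofReal_mul, abs_mul,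
    abs_of_nonneg ht] at *
  nlinarith

theorem ofReal_mem_cone {M t : ℝ} (ht : 0 ≤ t) : (t : ℂ) ∈ cone M := by
  simp [cone, ht]

theorem zero_mem_cone {M : ℝ} : (0 : ℂ) ∈ cone M := by simp [cone]

theorem re_nonneg_of_mem_cone {M : ℝ} (hM : 0 ≤ M) {z : ℂ} (hz : z ∈ cone M) : 0 ≤ z.re :=
  (mul_nonneg hM (abs_nonneg _)).trans hz

theorem re_mul_nonneg_of_mem_cone {M : ℝ} (hM : 0 < M) {z w : ℂ} (hz : z ∈ cone M)
    (hw : |w.im| ≤ M * w.re) : 0 ≤ (z * w).re := by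
  have hw0 : 0 ≤ w.re := by nlinarith [abs_nonneg w.im]
  have h1 : z.im * w.im ≤ |z.im| * |w.im| := by
    rw [← abs_mul]; exact le_abs_self _
  have h2 := mul_le_mul_of_nonneg_left hw (abs_nonneg z.im)
  have h3 := mul_le_mul_of_nonneg_right (show M * |z.im| ≤ z.re from hz) hw0
  rw [Complex.mul_re]
  nlinarith

theorem isOpen_openCone (M : ℝ) : IsOpen {z : ℂ | M * |z.im| < z.re} :=
  isOpen_lt (by fun_prop) (by fun_prop)

theorem openCone_subset_cone (M : ℝ) : {z : ℂ | M * |z.im| < z.re} ⊆ cone M :=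
  fun z (hz : M * |z.im| < z.re) => hz.le

theorem sector_subset_openCone {M : ℝ} (hM : 0 < M) :
    sector (Real.arctan M⁻¹) ⊆ {z : ℂ | M * |z.im| < z.re} := by
  rintro z ⟨hz, harg⟩
  have hπ : |z.arg| < Real.pi / 2 := harg.trans (Real.arctan_lt_pi_div_two _)
  have hcos : 0 < Real.cos |z.arg| :=
    Real.cos_pos_of_mem_Ioo ⟨by linarith [abs_nonneg z.arg, Real.pi_pos], hπ⟩
  have htan : Real.tan |z.arg| < M⁻¹ := by
    rw [← Real.tan_arctan M⁻¹]
    exact Real.tan_lt_tan_of_lt_of_lt_pi_div_two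
      (by linarith [abs_nonneg z.arg, Real.pi_pos]) (Real.arctan_lt_pi_div_two _) harg
  have hsin : M * Real.sin |z.arg| < Real.cos |z.arg| := by
    rw [Real.tan_eq_sin_div_cos, div_lt_iff₀ hcos] at htan
    calc M * Real.sin |z.arg| < M * (M⁻¹ * Real.cos |z.arg|) := by gcongr
      _ = _ := by field_simp
  have hn : 0 < ‖z‖ := norm_pos_iff.2 hz
  have hre : z.re = ‖z‖ * Real.cos |z.arg| := by
    rw [Real.cos_abs, Complex.norm_mul_cos_arg]
  have him : |z.im| = ‖z‖ * Real.sin |z.arg| := by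
    rw [← Complex.norm_mul_sin_arg z, abs_mul, abs_norm]
    congr 1
    rcases abs_cases z.arg with ⟨h, h0⟩ | ⟨h, h0⟩
    · rw [h, abs_of_nonneg]
      exact Real.sin_nonneg_of_nonneg_of_le_pi h0 (Complex.arg_le_pi z)
    · rw [h, Real.sin_neg, abs_of_nonpos]
      exact Real.sin_nonpos_of_nonpos_of_neg_pi_le h0.le (Complex.neg_pi_lt_arg z).le
  change M * |z.im| < z.re
  rw [hre, him]
  nlinarith

variable {H : Type*} [NormedAddCommGroup H] [InnerProductSpace ℂ H]

/-- `Γ` is the graph of an `m`-sectorial operator `B`, with the graph encoded as a linear relation: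
the numerical range of `B` lies in `|Im w| ≤ M Re w`, `B` is single-valued, and `s + B` is onto for
all `s > 0`. Density of the domain need not be assumed, see `exists_mem_norm_sub_lt`. -/
structure IsMSectorial (Γ : Submodule ℂ (H × H)) (M : ℝ) : Prop where
  pos : 0 < M
  abs_im_le : ∀ p ∈ Γ, |(inner ℂ p.1 p.2).im| ≤ M * (inner ℂ p.1 p.2).re
  snd_eq_zero : ∀ p ∈ Γ, p.1 = 0 → p.2 = 0
  surj : ∀ s : ℝ, 0 < s → ∀ y, ∃ p ∈ Γ, (s : ℂ) • p.1 + p.2 = y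

namespace IsMSectorial

variable {Γ : Submodule ℂ (H × H)} {M : ℝ} (h : IsMSectorial Γ M)
include h

theorem re_inner_nonneg {p : H × H} (hp : p ∈ Γ) : 0 ≤ (inner ℂ p.1 p.2).re := by
  nlinarith [h.abs_im_le p hp, abs_nonneg (inner ℂ p.1 p.2).im, h.pos]

theorem mul_norm_le {s : ℝ} {p : H × H} (hp : p ∈ Γ) :
    s * ‖p.1‖ ≤ ‖(s : ℂ) • p.1 + p.2‖ := by
  have h1 : (inner ℂ p.1 ((s : ℂ) • p.1 + p.2)).re = s * ‖p.1‖ ^ 2 + (inner ℂ p.1 p.2).re := by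
    rw [inner_add_right, inner_smul_right, inner_self_eq_norm_sq_to_K, Complex.add_re,
      Complex.re_ofReal_mul]
    norm_cast
  have h2 : (inner ℂ p.1 ((s : ℂ) • p.1 + p.2)).re ≤ ‖p.1‖ * ‖(s : ℂ) • p.1 + p.2‖ :=
    (Complex.re_le_norm _).trans (norm_inner_le_norm _ _)
  have h3 := h.re_inner_nonneg hp
  rcases (norm_nonneg p.1).eq_or_lt with h0 | h0
  · rw [← h0, mul_zero]; exact norm_nonneg _
  · refine le_of_mul_le_mul_left ?_ h0
    nlinarith

theorem eq_zero_of_smul_add_eq_zero {s : ℝ} (hs : 0 < s) {p : H × H} (hp : p ∈ Γ)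
    (h0 : (s : ℂ) • p.1 + p.2 = 0) : p.1 = 0 := by
  have := h.mul_norm_le (s := s) hp
  rw [h0, norm_zero] at this
  exact norm_eq_zero.1 (le_antisymm (by nlinarith [norm_nonneg p.1]) (norm_nonneg _))

theorem exists_resolvent {s : ℝ} (hs : 0 < s) :
    ∃ R : H →L[ℂ] H, ∀ y, (R y, y - (s : ℂ) • R y) ∈ Γ := by
  choose p hp hpy using h.surj s hs
  have huniq : ∀ y q, q ∈ Γ → (s : ℂ) • q.1 + q.2 = y → q.1 = (p y).1 := fun y q hq hqy => by
    have := h.eq_zero_of_smul_add_eq_zero hs (Γ.sub_mem hq (hp y)) (by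
      simp only [Prod.fst_sub, Prod.snd_sub, smul_sub]
      rw [sub_add_sub_comm, hqy, hpy, sub_self])
    exact sub_eq_zero.1 this
  let R₀ : H →ₗ[ℂ] H :=
    { toFun := fun y => (p y).1
      map_add' := fun x y => (huniq (x + y) (p x + p y) (Γ.add_mem (hp x) (hp y)) (by
        rw [Prod.fst_add, Prod.snd_add, smul_add, add_add_add_comm, hpy, hpy])).symm
      map_smul' := fun a y => (huniq (a • y) (a • p y) (Γ.smul_mem a (hp y)) (by
        rw [Prod.smul_fst, Prod.smul_snd, smul_comm, ← smul_add, hpy])).symm }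
  refine ⟨R₀.mkContinuous s⁻¹ fun y => ?_, fun y => ?_⟩
  · have := h.mul_norm_le (s := s) (hp y)
    rw [hpy] at this
    change ‖(p y).1‖ ≤ s⁻¹ * ‖y‖
    rw [inv_mul_eq_div, le_div_iff₀ hs]
    linarith
  · have e : y - (s : ℂ) • (p y).1 = (p y).2 := by
      nth_rewrite 1 [← hpy y]
      abel
    change ((p y).1, y - (s : ℂ) • (p y).1) ∈ Γ
    rw [e]
    exact hp y

/-- The resolvent `(n + 1 + B)⁻¹`. -/
def resolvent (n : ℕ) : H →L[ℂ] H :=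
  (h.exists_resolvent (s := (n + 1 : ℝ)) (by positivity)).choose

theorem resolvent_mem (n : ℕ) (y : H) :
    (h.resolvent n y, y - ((n + 1 : ℝ) : ℂ) • h.resolvent n y) ∈ Γ :=
  (h.exists_resolvent (s := (n + 1 : ℝ)) (by positivity)).choose_spec y

theorem resolvent_apply_of_mem (n : ℕ) {p : H × H} (hp : p ∈ Γ) :
    h.resolvent n (((n + 1 : ℝ) : ℂ) • p.1 + p.2) = p.1 := by
  have := h.eq_zero_of_smul_add_eq_zero (s := (n + 1 : ℝ)) (by positivity) (Γ.sub_mem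
    (h.resolvent_mem n (((n + 1 : ℝ) : ℂ) • p.1 + p.2)) hp) (by
      simp only [Prod.fst_sub, Prod.snd_sub, smul_sub]
      abel)
  exact sub_eq_zero.1 this

theorem norm_resolvent_le (n : ℕ) (y : H) : (n + 1 : ℝ) * ‖h.resolvent n y‖ ≤ ‖y‖ := by
  have := h.mul_norm_le (s := (n + 1 : ℝ)) (h.resolvent_mem n y)
  simpa using this

theorem resolvent_identity (n k : ℕ) (y : H) :
    h.resolvent k y - h.resolvent n y
      = ((n - k : ℝ) : ℂ) • h.resolvent n (h.resolvent k y) := by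
  have h1 := h.resolvent_apply_of_mem n (h.resolvent_mem k y)
  have e : ((n + 1 : ℝ) : ℂ) • h.resolvent k y + (y - ((k + 1 : ℝ) : ℂ) • h.resolvent k y)
      = y + ((n - k : ℝ) : ℂ) • h.resolvent k y := by
    push_cast
    module
  simp only [e, map_add, map_smul] at h1
  exact sub_eq_iff_eq_add'.2 h1.symm

theorem commute_resolvent (n k : ℕ) : Commute (h.resolvent n) (h.resolvent k) := by
  rcases eq_or_ne n k with rfl | hne
  · exact Commute.refl _
  · refine ContinuousLinearMap.ext fun y => ?_
    have h1 := h.resolvent_identity n k y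
    have h2 := h.resolvent_identity k n y
    have hnk : ((n - k : ℝ) : ℂ) ≠ 0 :=
      Complex.ofReal_ne_zero.2 (sub_ne_zero.2 (Nat.cast_injective.ne hne))
    refine smul_right_injective H hnk ?_
    simp only [mul_apply_eq_comp]
    rw [← h1, ← neg_sub (h.resolvent n y), h2, ← neg_smul]
    congr 1
    push_cast
    ring

/-- The Yosida approximation `-s B (s + B)⁻¹ = s² (s + B)⁻¹ - s` of `-B`, where `s = n + 1`. -/
def yosida (n : ℕ) : H →L[ℂ] H :=
  ((n + 1 : ℝ) : ℂ) • (((n + 1 : ℝ) : ℂ) • h.resolvent n - 1)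

theorem yosida_apply (n : ℕ) (x : H) :
    h.yosida n x = ((n + 1 : ℝ) : ℂ) • (((n + 1 : ℝ) : ℂ) • h.resolvent n x - x) := rfl

theorem commute_yosida (n k : ℕ) : Commute (h.yosida n) (h.yosida k) := by
  refine ((Commute.sub_left ?_ (Commute.one_left _)).smul_left _)
  refine Commute.smul_left ?_ _
  refine ((Commute.sub_right ?_ (Commute.one_right _)).smul_right _)
  exact (h.commute_resolvent n k).smul_right _

/-- With `u = (s + B)⁻¹ x` and `v = B u` one has `x = s u + v` and
`⟨x, yosida x⟩ = - s² ⟨u, v⟩ - s ‖v‖²`, which lies in the sector of `-B`. -/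
theorem re_mul_inner_yosida_nonpos (n : ℕ) {z : ℂ} (hz : z ∈ cone M) (x : H) :
    (inner ℂ x ((z • h.yosida n) x)).re ≤ 0 := by
  set u := h.resolvent n x with hu
  set s : ℝ := n + 1 with hs
  set v := x - (s : ℂ) • u with hv
  have hmem : (u, v) ∈ Γ := h.resolvent_mem n x
  have hx : x = (s : ℂ) • u + v := by rw [hv]; abel
  have hA : h.yosida n x = -((s : ℂ) • v) := by
    rw [yosida_apply, ← hu, ← hs, hv, ← smul_neg, neg_sub]
  have e : inner ℂ x ((z • h.yosida n) x)
      = -(((s ^ 2 : ℝ) : ℂ) * (z * inner ℂ u v) + ((s * ‖v‖ ^ 2 : ℝ) : ℂ) * z) := by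
    rw [smul_apply, hA]
    nth_rewrite 1 [hx]
    rw [inner_smul_right, inner_neg_right, inner_smul_right, inner_add_left, inner_smul_left,
      inner_self_eq_norm_sq_to_K, Complex.conj_ofReal]
    push_cast
    simp only [Complex.coe_algebraMap]
    ring
  rw [e, Complex.neg_re, Complex.add_re, Complex.re_ofReal_mul, Complex.re_ofReal_mul]
  have h1 := re_mul_nonneg_of_mem_cone h.pos hz (h.abs_im_le _ hmem)
  have h2 := re_nonneg_of_mem_cone h.pos.le hz
  have h3 : 0 ≤ s := by positivity
  simp only at h1
  have := mul_nonneg (sq_nonneg s) h1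
  have := mul_nonneg (mul_nonneg h3 (sq_nonneg ‖v‖)) h2
  linarith

theorem yosida_apply_of_mem (n : ℕ) {p : H × H} (hp : p ∈ Γ) :
    h.yosida n p.1 = -(((n + 1 : ℝ) : ℂ) • h.resolvent n p.2) := by
  have h1 := h.resolvent_apply_of_mem n hp
  rw [map_add, map_smul] at h1
  rw [yosida_apply, ← smul_neg]
  congr 1
  nth_rewrite 2 [← h1]
  abel

/-- The domain of an `m`-sectorial operator is dense: if `u + B u` is orthogonal to
the domain, then `‖u‖² + ⟨u, B u⟩ = 0`. -/
theorem exists_mem_norm_sub_lt [CompleteSpace H] (x : H) {ε : ℝ} (hε : 0 < ε) :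
    ∃ p ∈ Γ, ‖x - p.1‖ < ε := by
  have hdense : (Γ.map (LinearMap.fst ℂ H H)).topologicalClosure = ⊤ := by
    rw [Submodule.topologicalClosure_eq_top_iff, Submodule.eq_bot_iff]
    intro y hy
    obtain ⟨p, hp, hpy⟩ := h.surj 1 one_pos y
    have h1 : inner ℂ p.1 y = 0 := hy p.1 ⟨p, hp, rfl⟩
    have h2 := h.re_inner_nonneg hp
    have h3 : (inner ℂ p.1 y).re = ‖p.1‖ ^ 2 + (inner ℂ p.1 p.2).re := by
      rw [← hpy, inner_add_right, Complex.ofReal_one, one_smul, inner_self_eq_norm_sq_to_K,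
        Complex.add_re]
      norm_cast
    rw [h1, Complex.zero_re] at h3
    have h4 : p.1 = 0 := norm_eq_zero.1 (pow_eq_zero_iff two_ne_zero |>.1
      (by nlinarith [sq_nonneg ‖p.1‖]))
    rw [← hpy, h4, h.snd_eq_zero p hp h4, smul_zero, add_zero]
  have hx : x ∈ closure ((Γ.map (LinearMap.fst ℂ H H) : Submodule ℂ H) : Set H) := by
    rw [← Submodule.topologicalClosure_coe, hdense]; trivial
  obtain ⟨_, ⟨p, hp, rfl⟩, hlt⟩ := Metric.mem_closure_iff.1 hx ε hε
  exact ⟨p, hp, by rwa [dist_eq_norm] at hlt⟩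

theorem norm_resolvent_smul_sub_le (n : ℕ) {p : H × H} (hp : p ∈ Γ) :
    ‖((n + 1 : ℝ) : ℂ) • h.resolvent n p.1 - p.1‖ ≤ ‖p.2‖ / (n + 1) := by
  have h1 := h.resolvent_apply_of_mem n hp
  rw [map_add, map_smul] at h1
  have e : ((n + 1 : ℝ) : ℂ) • h.resolvent n p.1 - p.1 = -h.resolvent n p.2 := by
    nth_rewrite 2 [← h1]
    abel
  rw [e, norm_neg, le_div_iff₀ (by positivity), mul_comm]
  exact h.norm_resolvent_le n p.2

variable [CompleteSpace H]

theorem tendsto_resolvent_smul (x : H) :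
    Tendsto (fun n : ℕ => ((n + 1 : ℝ) : ℂ) • h.resolvent n x) atTop (𝓝 x) := by
  rw [Metric.tendsto_atTop]
  intro ε hε
  obtain ⟨p, hp, hpx⟩ := h.exists_mem_norm_sub_lt x (ε := ε / 3) (by positivity)
  obtain ⟨N, hN⟩ := exists_nat_gt (‖p.2‖ / (ε / 3))
  refine ⟨N, fun n hn => ?_⟩
  have hn' : (N : ℝ) ≤ n := by exact_mod_cast hn
  have h1 := h.norm_resolvent_smul_sub_le n hp
  have h2 : ‖p.2‖ / (n + 1) ≤ ε / 3 := by
    rw [div_le_iff₀ (by positivity)]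
    rw [div_lt_iff₀ (by positivity)] at hN
    nlinarith
  have h3 : ‖((n + 1 : ℝ) : ℂ) • h.resolvent n (x - p.1)‖ ≤ ‖x - p.1‖ := by
    rw [norm_smul, Complex.norm_real, Real.norm_of_nonneg (by positivity)]
    exact h.norm_resolvent_le n _
  have e : ((n + 1 : ℝ) : ℂ) • h.resolvent n x - x
      = ((n + 1 : ℝ) : ℂ) • h.resolvent n (x - p.1)
        + (((n + 1 : ℝ) : ℂ) • h.resolvent n p.1 - p.1) - (x - p.1) := by
    rw [map_sub, smul_sub]
    abel
  rw [dist_eq_norm, e]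
  refine (norm_sub_le _ _).trans_lt ?_
  linarith [norm_add_le (((n + 1 : ℝ) : ℂ) • h.resolvent n (x - p.1))
    (((n + 1 : ℝ) : ℂ) • h.resolvent n p.1 - p.1)]

theorem tendsto_yosida {p : H × H} (hp : p ∈ Γ) :
    Tendsto (fun n => h.yosida n p.1) atTop (𝓝 (-p.2)) := by
  simp only [h.yosida_apply_of_mem _ hp]
  exact (h.tendsto_resolvent_smul p.2).neg

theorem norm_exp_yosida_le (n : ℕ) {z : ℂ} (hz : z ∈ cone M) :
    ‖NormedSpace.exp (z • h.yosida n)‖ ≤ 1 :=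
  norm_exp_le_one_of_dissipative (h.re_mul_inner_yosida_nonpos n hz)

theorem norm_exp_ofReal_smul_yosida_le (n : ℕ) {z : ℂ} (hz : z ∈ cone M) {t : ℝ} (ht : 0 ≤ t) :
    ‖NormedSpace.exp ((t : ℂ) • z • h.yosida n)‖ ≤ 1 := by
  rw [smul_smul]
  exact h.norm_exp_yosida_le n (ofReal_mul_mem_cone ht hz)

theorem norm_exp_yosida_sub_le (n k : ℕ) {z : ℂ} (hz : z ∈ cone M) (x : H) :
    ‖NormedSpace.exp (z • h.yosida n) x - NormedSpace.exp (z • h.yosida k) x‖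
      ≤ ‖z‖ * ‖h.yosida n x - h.yosida k x‖ := by
  refine (norm_exp_sub_exp_le (((h.commute_yosida n k).smul_left z).smul_right z)
    (fun t ht => h.norm_exp_ofReal_smul_yosida_le n hz ht)
    (fun t ht => h.norm_exp_ofReal_smul_yosida_le k hz ht) x).trans_eq ?_
  rw [smul_apply, smul_apply, ← smul_sub, norm_smul]

/-- Strong convergence on the domain of `B` carries over to all of `H` by density, as the
exponentials are contractions. -/
theorem uniformCauchySeqOn_exp_yosida (x : H) (r : ℝ) :
    UniformCauchySeqOn (fun n z => NormedSpace.exp (z • h.yosida n) x) atTop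
      (cone M ∩ Metric.ball 0 r) := by
  rw [Metric.uniformCauchySeqOn_iff]
  intro ε hε
  obtain ⟨p, hp, hpx⟩ := h.exists_mem_norm_sub_lt x (ε := ε / 3) (by positivity)
  obtain ⟨N, hN⟩ := Metric.cauchySeq_iff.1 (h.tendsto_yosida hp).cauchySeq (ε / (3 * (|r| + 1)))
    (by positivity)
  refine ⟨N, fun n hn k hk z hz => ?_⟩
  have h1 := h.norm_exp_yosida_sub_le n k hz.1 p.1
  have h2 := hN n hn k hk
  rw [dist_eq_norm, lt_div_iff₀ (by positivity)] at h2
  have hz2 : ‖z‖ ≤ |r| + 1 := by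
    have := hz.2
    rw [mem_ball_zero_iff] at this
    linarith [le_abs_self r]
  have h3 := mul_le_mul_of_nonneg_right hz2 (norm_nonneg (h.yosida n p.1 - h.yosida k p.1))
  have hb : ∀ j : ℕ, ‖NormedSpace.exp (z • h.yosida j) (x - p.1)‖ ≤ ‖x - p.1‖ := fun j => by
    simpa using ContinuousLinearMap.le_of_opNorm_le _ (h.norm_exp_yosida_le j hz.1) (x - p.1)
  have e : NormedSpace.exp (z • h.yosida n) x - NormedSpace.exp (z • h.yosida k) x
      = NormedSpace.exp (z • h.yosida n) (x - p.1) - NormedSpace.exp (z • h.yosida k) (x - p.1)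
        + (NormedSpace.exp (z • h.yosida n) p.1 - NormedSpace.exp (z • h.yosida k) p.1) := by
    rw [map_sub, map_sub]
    abel
  rw [dist_eq_norm, e]
  refine (norm_add_le _ _).trans_lt ?_
  linarith [norm_sub_le (NormedSpace.exp (z • h.yosida n) (x - p.1))
    (NormedSpace.exp (z • h.yosida k) (x - p.1)), hb n, hb k]

theorem exists_tendsto_exp_yosida (z : ℂ) : ∃ T : H →L[ℂ] H, z ∈ cone M →
    ∀ x, Tendsto (fun n => NormedSpace.exp (z • h.yosida n) x) atTop (𝓝 (T x)) := by
  by_cases hz : z ∈ cone M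
  · have hlim : ∀ x, ∃ y, Tendsto (fun n => NormedSpace.exp (z • h.yosida n) x) atTop (𝓝 y) :=
      fun x => cauchySeq_tendsto_of_complete
        ((h.uniformCauchySeqOn_exp_yosida x (‖z‖ + 1)).cauchySeq ⟨hz, by simp⟩)
    choose T₀ hT₀ using hlim
    exact ⟨continuousLinearMapOfTendsto (fun n => NormedSpace.exp (z • h.yosida n))
      (tendsto_pi_nhds.2 hT₀), fun _ => hT₀⟩
  · exact ⟨0, fun hz' => absurd hz' hz⟩

/-- The contraction semigroup `exp (-z B)` on the cone, the strong limit of the exponentials of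
the Yosida approximations. Its values outside the cone are irrelevant. -/
def expNeg (z : ℂ) : H →L[ℂ] H := (h.exists_tendsto_exp_yosida z).choose

theorem tendsto_expNeg {z : ℂ} (hz : z ∈ cone M) (x : H) :
    Tendsto (fun n => NormedSpace.exp (z • h.yosida n) x) atTop (𝓝 (h.expNeg z x)) :=
  (h.exists_tendsto_exp_yosida z).choose_spec hz x

theorem tendstoUniformlyOn_expNeg (x : H) (r : ℝ) :
    TendstoUniformlyOn (fun n z => NormedSpace.exp (z • h.yosida n) x) (fun z => h.expNeg z x)
      atTop (cone M ∩ Metric.ball 0 r) :=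
  (h.uniformCauchySeqOn_exp_yosida x r).tendstoUniformlyOn_of_tendsto
    fun _ hz => h.tendsto_expNeg hz.1 x

theorem expNeg_zero : h.expNeg 0 = ContinuousLinearMap.id ℂ H := by
  refine ContinuousLinearMap.ext fun x => ?_
  refine tendsto_nhds_unique (h.tendsto_expNeg zero_mem_cone x) ?_
  simp

theorem norm_expNeg_le {z : ℂ} (hz : z ∈ cone M) : ‖h.expNeg z‖ ≤ 1 := by
  refine ContinuousLinearMap.opNorm_le_bound _ zero_le_one fun x => ?_
  exact le_of_tendsto (h.tendsto_expNeg hz x).norm (Eventually.of_forall fun n =>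
    ContinuousLinearMap.le_of_opNorm_le _ (h.norm_exp_yosida_le n hz) x)

theorem expNeg_add {z w : ℂ} (hz : z ∈ cone M) (hw : w ∈ cone M) :
    h.expNeg (z + w) = (h.expNeg z).comp (h.expNeg w) := by
  refine ContinuousLinearMap.ext fun x => ?_
  refine tendsto_nhds_unique (h.tendsto_expNeg (add_mem_cone h.pos.le hz hw) x) ?_
  have h1 := h.tendsto_expNeg hz (h.expNeg w x)
  have h2 : Tendsto (fun n => NormedSpace.exp (z • h.yosida n)
      (NormedSpace.exp (w • h.yosida n) x - h.expNeg w x)) atTop (𝓝 0) := by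
    refine squeeze_zero_norm (fun n => ContinuousLinearMap.le_of_opNorm_le _
      (h.norm_exp_yosida_le n hz) _) ?_
    simpa using ((h.tendsto_expNeg hw x).sub_const (h.expNeg w x)).norm
  have h3 := h2.add h1
  simp only [map_sub, sub_add_cancel, zero_add] at h3
  simpa only [exp_add_smul, mul_apply_eq_comp, ContinuousLinearMap.comp_apply] using h3

theorem differentiable_exp_yosida (n : ℕ) (x : H) :
    Differentiable ℂ fun z : ℂ => NormedSpace.exp (z • h.yosida n) x := fun z =>
  ((hasDerivAt_exp_smul (h.yosida n) z).clm_apply (hasDerivAt_const z x)).differentiableAt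

theorem differentiableOn_expNeg :
    DifferentiableOn ℂ h.expNeg {z : ℂ | M * |z.im| < z.re} := by
  refine differentiableOn_clm_of_forall_apply (K := 1) (isOpen_openCone M)
    (fun z hz => h.norm_expNeg_le (openCone_subset_cone M hz)) fun x => ?_
  refine TendstoLocallyUniformlyOn.differentiableOn (φ := atTop)
    (F := fun n z => NormedSpace.exp (z • h.yosida n) x) ?_
    (Eventually.of_forall fun n => (h.differentiable_exp_yosida n x).differentiableOn)
    (isOpen_openCone M)
  refine tendstoLocallyUniformlyOn_of_forall_exists_nhds fun z hz => ?_
  refine ⟨{z : ℂ | M * |z.im| < z.re} ∩ Metric.ball 0 (‖z‖ + 1), ?_, ?_⟩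
  · exact inter_mem self_mem_nhdsWithin
      (mem_nhdsWithin_of_mem_nhds (Metric.isOpen_ball.mem_nhds (by simp)))
  · exact (h.tendstoUniformlyOn_expNeg x _).mono
      (Set.inter_subset_inter_left _ (openCone_subset_cone M))

theorem tendsto_expNeg_zero (x : H) :
    Tendsto (fun z => h.expNeg z x) (𝓝[cone M] 0) (𝓝 x) := by
  have hc : ContinuousOn (fun z => h.expNeg z x) (cone M ∩ Metric.ball 0 1) :=
    (h.tendstoUniformlyOn_expNeg x 1).continuousOn (Eventually.of_forall fun n =>
      (h.differentiable_exp_yosida n x).continuous.continuousOn).frequently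
  have := hc 0 ⟨zero_mem_cone, by simp⟩
  rw [ContinuousWithinAt, h.expNeg_zero, nhdsWithin_inter_of_mem'
    (mem_nhdsWithin_of_mem_nhds (Metric.ball_mem_nhds 0 one_pos))] at this
  exact this

end IsMSectorial

end Generation

/-! ### The generator and the generation theorem -/

section Generator

variable {H : Type*} [NormedAddCommGroup H] [InnerProductSpace ℂ H] [CompleteSpace H]

namespace IsMSectorial

variable {Γ : Submodule ℂ (H × H)} {M : ℝ} (h : IsMSectorial Γ M)
include h

theorem tendsto_quotient_expNeg_of_mem {p : H × H} (hp : p ∈ Γ) :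
    Tendsto (fun t : ℝ => ((t⁻¹ : ℝ) : ℂ) • (h.expNeg t p.1 - p.1)) (𝓝[>] 0) (𝓝 (-p.2)) := by
  rw [Metric.tendsto_nhdsWithin_nhds]
  intro ε hε
  obtain ⟨δ, hδ, hδT⟩ := (Metric.tendsto_nhdsWithin_nhds.1 (h.tendsto_expNeg_zero p.2)) (ε / 4)
    (by positivity)
  refine ⟨δ, hδ, fun t (ht : 0 < t) htδ => ?_⟩
  have htδ' : t < δ := by
    rw [dist_eq_norm, sub_zero, Real.norm_of_nonneg ht.le] at htδ
    exact htδ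
  have hcone : ∀ s : ℝ, 0 ≤ s → ((s * t : ℝ) : ℂ) ∈ cone M := fun s hs =>
    ofReal_mem_cone (mul_nonneg hs ht.le)
  -- the Taylor estimate for the Yosida approximations, uniformly in `n`
  have key : ∀ᶠ n in atTop, ‖NormedSpace.exp ((t : ℂ) • h.yosida n) p.1 - p.1
      - ((t : ℂ) • h.yosida n) p.1‖ ≤ t * (3 * ε / 4) := by
    have e1 := (Metric.tendstoUniformlyOn_iff.1 (h.tendstoUniformlyOn_expNeg p.2 δ)) (ε / 4)
      (by positivity)
    have e2 := (Metric.tendsto_nhds.1 (h.tendsto_yosida hp)) (ε / 8) (by positivity)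
    filter_upwards [e1, e2] with n h1 h2
    rw [dist_eq_norm, sub_neg_eq_add] at h2
    refine norm_exp_sub_sub_le p.1 fun s hs0 hs1 => ?_
    rw [smul_smul, ← Complex.ofReal_mul, smul_apply, map_smul, ← smul_sub, norm_smul,
      Complex.norm_real, Real.norm_of_nonneg ht.le]
    refine mul_le_mul_of_nonneg_left ?_ ht.le
    have hb : ((s * t : ℝ) : ℂ) ∈ Metric.ball (0 : ℂ) δ := by
      rw [mem_ball_zero_iff, Complex.norm_real, Real.norm_of_nonneg (mul_nonneg hs0 ht.le)]
      nlinarith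
    have h3 := h1 _ ⟨hcone s hs0, hb⟩
    have h4 := hδT (hcone s hs0) hb
    rw [dist_eq_norm] at h3 h4
    set E := NormedSpace.exp (((s * t : ℝ) : ℂ) • h.yosida n) with hE
    have h5 : ‖E (h.yosida n p.1 + p.2)‖ ≤ ‖h.yosida n p.1 + p.2‖ := by
      refine (ContinuousLinearMap.le_of_opNorm_le _ (h.norm_exp_yosida_le n (hcone s hs0))
        (h.yosida n p.1 + p.2)).trans_eq (one_mul _)
    have e : E (h.yosida n p.1) - h.yosida n p.1
        = (E (h.yosida n p.1 + p.2) - (h.yosida n p.1 + p.2))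
          + ((h.expNeg ((s * t : ℝ) : ℂ) p.2 - E p.2)
            - (h.expNeg ((s * t : ℝ) : ℂ) p.2 - p.2)) := by
      rw [map_add]
      abel
    rw [e]
    refine (norm_add_le _ _).trans ?_
    linarith [norm_sub_le (E (h.yosida n p.1 + p.2)) (h.yosida n p.1 + p.2),
      norm_sub_le (h.expNeg ((s * t : ℝ) : ℂ) p.2 - E p.2)
        (h.expNeg ((s * t : ℝ) : ℂ) p.2 - p.2)]
  have hlim : ‖h.expNeg t p.1 - p.1 - (t : ℂ) • (-p.2)‖ ≤ t * (3 * ε / 4) := by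
    refine le_of_tendsto ((((h.tendsto_expNeg (ofReal_mem_cone ht.le) p.1).sub_const p.1).sub
      ((h.tendsto_yosida hp).const_smul (t : ℂ))).norm) ?_
    filter_upwards [key] with n hn using hn
  have e : ((t⁻¹ : ℝ) : ℂ) • (h.expNeg t p.1 - p.1) - -p.2
      = ((t⁻¹ : ℝ) : ℂ) • (h.expNeg t p.1 - p.1 - (t : ℂ) • (-p.2)) := by
    rw [smul_sub _ (h.expNeg t p.1 - p.1), smul_smul, ← Complex.ofReal_mul,
      inv_mul_cancel₀ ht.ne', Complex.ofReal_one, one_smul]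
  rw [dist_eq_norm, e, norm_smul, Complex.norm_real, Real.norm_of_nonneg (by positivity),
    inv_mul_eq_div, div_lt_iff₀ ht]
  nlinarith

/-- The converse inclusion holds because the generator of a contraction semigroup is dissipative
and therefore has no proper extension of `-B`. -/
theorem mem_iff_tendsto_expNeg (x y : H) : (x, y) ∈ Γ ↔
    Tendsto (fun t : ℝ => ((t⁻¹ : ℝ) : ℂ) • (h.expNeg t x - x)) (𝓝[>] 0) (𝓝 (-y)) := by
  refine ⟨fun hp => h.tendsto_quotient_expNeg_of_mem hp, fun hxy => ?_⟩
  obtain ⟨p, hp, hpy⟩ := h.surj 1 one_pos (x + y)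
  rw [Complex.ofReal_one, one_smul] at hpy
  set w := x - p.1 with hw
  have hyw : -y - -p.2 = w := by
    rw [hw, sub_neg_eq_add, ← sub_eq_zero]
    have : p.2 = x + y - p.1 := by rw [← hpy]; abel
    rw [this]
    abel
  have hlim := hxy.sub (h.tendsto_quotient_expNeg_of_mem hp)
  rw [hyw] at hlim
  have hre : Tendsto (fun t : ℝ => (inner ℂ w (((t⁻¹ : ℝ) : ℂ) • (h.expNeg t x - x)
      - ((t⁻¹ : ℝ) : ℂ) • (h.expNeg t p.1 - p.1))).re) (𝓝[>] 0) (𝓝 (inner ℂ w w).re) :=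
    (Complex.continuous_re.tendsto _).comp (tendsto_const_nhds.inner hlim)
  have hle : (inner ℂ w w).re ≤ 0 := by
    refine le_of_tendsto hre ?_
    filter_upwards [self_mem_nhdsWithin] with t (ht : 0 < t)
    have e : ((t⁻¹ : ℝ) : ℂ) • (h.expNeg t x - x) - ((t⁻¹ : ℝ) : ℂ) • (h.expNeg t p.1 - p.1)
        = ((t⁻¹ : ℝ) : ℂ) • (h.expNeg t w - w) := by
      rw [← smul_sub, hw, map_sub]
      congr 1
      abel
    rw [e, inner_smul_right, Complex.re_ofReal_mul, inner_sub_right, Complex.sub_re]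
    have h1 : (inner ℂ w (h.expNeg t w)).re ≤ ‖w‖ * ‖w‖ := by
      refine (Complex.re_le_norm _).trans ((norm_inner_le_norm _ _).trans ?_)
      gcongr
      simpa using ContinuousLinearMap.le_of_opNorm_le _
        (h.norm_expNeg_le (ofReal_mem_cone (M := M) ht.le)) w
    have h2 : (inner ℂ w w).re = ‖w‖ * ‖w‖ := by
      rw [inner_self_eq_norm_sq_to_K, sq]
      norm_cast
    rw [h2]
    exact mul_nonpos_of_nonneg_of_nonpos (inv_nonneg.2 ht.le) (by linarith)
  have hw0 : w = 0 := by
    have h2 : (inner ℂ w w).re = ‖w‖ ^ 2 := by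
      rw [inner_self_eq_norm_sq_to_K]
      norm_cast
    rw [h2] at hle
    exact norm_eq_zero.1 (pow_eq_zero_iff two_ne_zero |>.1 (le_antisymm hle (sq_nonneg _)))
  have hx : x = p.1 := sub_eq_zero.1 hw0
  have hy : y = p.2 := by
    rw [hx] at hpy
    exact (add_left_cancel hpy).symm
  rw [hx, hy]
  exact hp

end IsMSectorial

omit [CompleteSpace H] in
/-- Rescaling a semigroup by `exp (ω t)` adds `ω` to its generator. -/
theorem tendsto_quotient_rescale (ω : ℝ) {T : ℝ → H →L[ℂ] H} {x y : H}
    (hT : Tendsto (fun t : ℝ => ((t⁻¹ : ℝ) : ℂ) • (T t x - x)) (𝓝[>] 0) (𝓝 y)) :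
    Tendsto (fun t : ℝ => ((t⁻¹ : ℝ) : ℂ) • (((Real.exp (ω * t) : ℝ) : ℂ) • T t x - x)) (𝓝[>] 0)
      (𝓝 (y + (ω : ℂ) • x)) := by
  have hder : HasDerivAt (fun t : ℝ => ((Real.exp (ω * t) : ℝ) : ℂ)) (ω : ℂ) 0 := by
    have : HasDerivAt (fun t : ℝ => Real.exp (ω * t)) ω 0 := by
      simpa using ((hasDerivAt_id (0 : ℝ)).const_mul ω).exp
    exact this.ofReal_comp
  have h1 : Tendsto (fun t : ℝ => ((t⁻¹ : ℝ) : ℂ) * (((Real.exp (ω * t) : ℝ) : ℂ) - 1)) (𝓝[>] 0)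
      (𝓝 (ω : ℂ)) := by
    have := hder.tendsto_slope_zero_right
    simpa using this
  have h2 : Tendsto (fun t : ℝ => ((Real.exp (ω * t) : ℝ) : ℂ)) (𝓝[>] 0) (𝓝 1) := by
    have := hder.continuousAt.tendsto.mono_left (nhdsWithin_le_nhds (s := Set.Ioi 0))
    simpa using this
  have h3 := (h2.smul hT).add (h1.smul_const x)
  rw [one_smul] at h3
  refine h3.congr fun t => ?_
  module

/-- The generation theorem for quasi-`m`-sectorial operators: if `ω - L` is `m`-sectorial then `L`
generates the analytic semigroup `exp (ω t) exp (-t (ω - L))`. -/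
theorem exists_isAnalyticC0Semigroup {L : H →ₗ.[ℂ] H} {Γ : Submodule ℂ (H × H)} {M ω : ℝ}
    (h : IsMSectorial Γ M) (hL : ∀ x y, (x, y) ∈ L.graph ↔ (x, (ω : ℂ) • x - y) ∈ Γ) :
    ∃ S : ℝ → H →L[ℂ] H, IsAnalyticC0Semigroup S ∧ IsGenerator L S ∧
      ∀ t : ℝ, 0 ≤ t → ‖S t‖ ≤ Real.exp (ω * t) := by
  set T : ℂ → H →L[ℂ] H := fun z => Complex.exp (ω * z) • h.expNeg z with hT
  have hcone : sector (Real.arctan M⁻¹) ⊆ cone M :=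
    (sector_subset_openCone h.pos).trans (openCone_subset_cone M)
  have hadd : ∀ z ∈ cone M, ∀ w ∈ cone M, T (z + w) = (T z).comp (T w) := fun z hz w hw => by
    refine ContinuousLinearMap.ext fun x => ?_
    simp only [hT, h.expNeg_add hz hw, mul_add, Complex.exp_add, smul_apply,
      ContinuousLinearMap.comp_apply, map_smul, smul_smul]
    rw [mul_comm]
  have hlim : ∀ x, Tendsto (fun z => T z x) (𝓝[cone M] 0) (𝓝 x) := fun x => by
    have h1 : Tendsto (fun z : ℂ => Complex.exp (ω * z)) (𝓝[cone M] 0) (𝓝 1) := by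
      have : Continuous fun z : ℂ => Complex.exp (ω * z) := by fun_prop
      simpa using (this.tendsto 0).mono_left (nhdsWithin_le_nhds (s := cone M))
    have h2 := h1.smul (h.tendsto_expNeg_zero x)
    rwa [one_smul] at h2
  have hreal : ∀ t : ℝ, T t = ((Real.exp (ω * t) : ℝ) : ℂ) • h.expNeg t := fun t => by
    simp [hT]
  refine ⟨fun t => T t, ⟨⟨?_, fun s t hs ht => ?_, fun x => ?_⟩, Real.arctan M⁻¹,
    Real.arctan_pos.2 (inv_pos.2 h.pos), (Real.arctan_lt_pi_div_two _).le, T, fun t _ => rfl,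
    ?_, fun z hz w hw => hadd z (hcone hz) w (hcone hw), fun δ' _ hδ' x => ?_⟩,
    fun x y => ?_, fun t ht => ?_⟩
  · simp [hT, h.expNeg_zero]
  · simp only [Complex.ofReal_add]
    exact hadd s (ofReal_mem_cone hs) t (ofReal_mem_cone ht)
  · refine (hlim x).comp (tendsto_nhdsWithin_iff.2 ⟨?_, ?_⟩)
    · simpa using (Complex.continuous_ofReal.tendsto 0).mono_left
        (nhdsWithin_le_nhds (s := Set.Ioi 0))
    · filter_upwards [self_mem_nhdsWithin] with t (ht : 0 < t) using ofReal_mem_cone ht.le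
  · refine DifferentiableOn.fun_smul ?_ (h.differentiableOn_expNeg.mono
      (sector_subset_openCone h.pos))
    exact Differentiable.differentiableOn (by fun_prop)
  · exact (hlim x).mono_left (nhdsWithin_mono 0
      (fun z hz => hcone ⟨hz.1, hz.2.trans hδ'⟩))
  · rw [hL, h.mem_iff_tendsto_expNeg]
    simp only [hreal, smul_apply]
    constructor
    · intro ht
      convert tendsto_quotient_rescale (T := fun t => h.expNeg t) ω ht using 2
      abel
    · intro ht
      have := tendsto_quotient_rescale
        (T := fun t : ℝ => ((Real.exp (ω * t) : ℝ) : ℂ) • h.expNeg t) (-ω) ht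
      simp only [smul_apply, smul_smul, ← Complex.ofReal_mul, ← Real.exp_add, neg_mul,
        neg_add_cancel, Real.exp_zero, Complex.ofReal_one, one_smul] at this
      convert this using 2
      push_cast
      module
  · simp only [hreal, norm_smul, Complex.norm_real, Real.norm_of_nonneg (Real.exp_pos _).le]
    exact mul_le_of_le_one_right (Real.exp_pos _).le (h.norm_expNeg_le (ofReal_mem_cone ht))

end Generator

/-! ### The Lax–Milgram theorem for closed sectorial forms -/

section LaxMilgram

variable {E : Type*} [AddCommGroup E] [Module ℂ E]

theorem re_nonneg_of_sectorial {b : E →ₗ[ℂ] E →ₗ⋆[ℂ] ℂ} {M : ℝ} (hM : 0 < M)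
    (hb : ∀ u, |(b u u).im| ≤ M * (b u u).re) (u : E) : 0 ≤ (b u u).re := by
  nlinarith [hb u, abs_nonneg (b u u).im]

/-- A sectorial sesquilinear form is controlled by its real part on the diagonal, by
polarization. -/
theorem norm_le_of_sectorial {b : E →ₗ[ℂ] E →ₗ⋆[ℂ] ℂ} {M : ℝ} (hM : 0 < M)
    (hb : ∀ u, |(b u u).im| ≤ M * (b u u).re) (u v : E) :
    ‖b u v‖ ≤ (1 + M) * ((b u u).re + (b v v).re) := by
  have hdiag : ∀ w, ‖b w w‖ ≤ (1 + M) * (b w w).re := fun w => by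
    have h1 := Complex.norm_le_abs_re_add_abs_im (b w w)
    rw [abs_of_nonneg (re_nonneg_of_sectorial hM hb w)] at h1
    linarith [hb w]
  have hpol : 4 * b u v = b (u + v) (u + v) - b (u - v) (u - v)
      + Complex.I * b (u + Complex.I • v) (u + Complex.I • v)
      - Complex.I * b (u - Complex.I • v) (u - Complex.I • v) := by
    simp only [map_add, map_sub, LinearMap.add_apply, LinearMap.sub_apply, map_smul,
      LinearMap.smul_apply, map_smulₛₗ, smul_eq_mul, Complex.conj_I]
    linear_combination (2 * b u v - 2 * b v u) * Complex.I_sq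
  have hsum : (b (u + v) (u + v)).re + (b (u - v) (u - v)).re
      + (b (u + Complex.I • v) (u + Complex.I • v)).re
      + (b (u - Complex.I • v) (u - Complex.I • v)).re = 4 * ((b u u).re + (b v v).re) := by
    simp only [map_add, map_sub, LinearMap.add_apply, LinearMap.sub_apply, map_smul,
      LinearMap.smul_apply, map_smulₛₗ, smul_eq_mul, Complex.conj_I, Complex.add_re,
      Complex.sub_re, Complex.add_im, Complex.sub_im, Complex.mul_re, Complex.mul_im,
      Complex.neg_re, Complex.neg_im,
      Complex.I_re, Complex.I_im]
    ring
  have hn : ‖4 * b u v‖ ≤ ‖b (u + v) (u + v)‖ + ‖b (u - v) (u - v)‖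
      + ‖b (u + Complex.I • v) (u + Complex.I • v)‖
      + ‖b (u - Complex.I • v) (u - Complex.I • v)‖ := by
    rw [hpol]
    refine (norm_sub_le _ _).trans ?_
    rw [norm_mul Complex.I, Complex.norm_I, one_mul]
    gcongr
    refine (norm_add_le _ _).trans ?_
    rw [norm_mul Complex.I, Complex.norm_I, one_mul]
    gcongr
    exact norm_sub_le _ _
  rw [norm_mul, Complex.norm_ofNat] at hn
  have := hdiag (u + v)
  have := hdiag (u - v)
  have := hdiag (u + Complex.I • v)
  have := hdiag (u - Complex.I • v)
  have h4 : (1 + M) * ((b (u + v) (u + v)).re + (b (u - v) (u - v)).re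
      + (b (u + Complex.I • v) (u + Complex.I • v)).re
      + (b (u - Complex.I • v) (u - Complex.I • v)).re)
      = (1 + M) * (4 * ((b u u).re + (b v v).re)) := by rw [hsum]
  linarith

variable {H : Type*} [NormedAddCommGroup H] [InnerProductSpace ℂ H]

/-- The real inner product `Re (b(u, v) + b(v, u)) / 2`, whose square norm is `Re b(u, u)`. -/
abbrev realCore (b : E →ₗ[ℂ] E →ₗ⋆[ℂ] ℂ) (hnonneg : ∀ u, 0 ≤ (b u u).re)
    (hdef : ∀ u, (b u u).re = 0 → u = 0) : InnerProductSpace.Core ℝ E where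
  inner u v := ((b u v).re + (b v u).re) / 2
  conj_inner_symm u v := by
    simp only [conj_trivial]
    ring
  re_inner_nonneg u := by
    simp only [RCLike.re_to_real]
    linarith [hnonneg u]
  add_left u v w := by
    simp only [map_add, LinearMap.add_apply, Complex.add_re]
    ring
  smul_left u v r := by
    simp only [← Complex.coe_smul, map_smul, LinearMap.smul_apply, map_smulₛₗ, smul_eq_mul,
      conj_trivial, Complex.conj_ofReal, Complex.re_ofReal_mul]
    ring
  definite u h := hdef u (by linarith)

/-- The Lax–Milgram theorem for a closed sectorial form `b` that dominates the norm of `H`: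
`b + s` is invertible for `s ≥ 0`. The form domain `E` is a real Hilbert space for the symmetric
part of `Re b`, on which `Re b + s` is bounded and coercive. -/
theorem exists_forall_form_add_inner_eq {b : E →ₗ[ℂ] E →ₗ⋆[ℂ] ℂ} {j : E →ₗ[ℂ] H}
    (hj : Function.Injective j) {M : ℝ} (hM : 0 < M)
    (hb : ∀ u, |(b u u).im| ≤ M * (b u u).re) (hcoer : ∀ u, ‖j u‖ ^ 2 ≤ (b u u).re)
    (hcomp : ∀ u : ℕ → E, (∀ ε > 0, ∃ N, ∀ m ≥ N, ∀ n ≥ N, (b (u m - u n) (u m - u n)).re < ε) →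
      ∃ v, Tendsto (fun n => (b (u n - v) (u n - v)).re) atTop (𝓝 0))
    {s : ℝ} (hs : 0 ≤ s) (y : H) :
    ∃ u : E, ∀ v : E, b u v + s * inner ℂ (j v) (j u) = inner ℂ (j v) y := by
  have hnonneg := re_nonneg_of_sectorial hM hb
  have hdef : ∀ u, (b u u).re = 0 → u = 0 := fun u hu => by
    have h1 := hcoer u
    rw [hu] at h1
    have h2 : j u = 0 := norm_eq_zero.1 (pow_eq_zero_iff two_ne_zero |>.1
      (le_antisymm h1 (sq_nonneg _)))
    exact hj (by rw [h2, map_zero])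
  let core := realCore b hnonneg hdef
  let _ : NormedAddCommGroup E := core.toNormedAddCommGroup
  let _ : InnerProductSpace ℝ E := InnerProductSpace.ofCore core.toCore
  have hnorm : ∀ u : E, ‖u‖ ^ 2 = (b u u).re := fun u => by
    rw [← real_inner_self_eq_norm_sq]
    change ((b u u).re + (b u u).re) / 2 = _
    ring
  have hjn : ∀ u : E, ‖j u‖ ≤ ‖u‖ := fun u =>
    le_of_sq_le_sq ((hcoer u).trans_eq (hnorm u).symm) (norm_nonneg _)
  have hcomplete : CompleteSpace E := by
    refine Metric.complete_of_cauchySeq_tendsto fun u hu => ?_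
    obtain ⟨v, hv⟩ := hcomp u fun ε hε => by
      obtain ⟨N, hN⟩ := Metric.cauchySeq_iff.1 hu (Real.sqrt ε) (Real.sqrt_pos.2 hε)
      refine ⟨N, fun m hm n hn => ?_⟩
      rw [← hnorm, ← dist_eq_norm]
      exact (Real.lt_sqrt dist_nonneg).1 (hN m hm n hn)
    refine ⟨v, tendsto_iff_norm_sub_tendsto_zero.2 ?_⟩
    simp only [← hnorm] at hv
    have := hv.sqrt
    simpa [Real.sqrt_sq (norm_nonneg _)] using this
  have hbound : ∀ u v : E, ‖b u v‖ ≤ 2 * (1 + M) * ‖u‖ * ‖v‖ := fun u v => by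
    rcases eq_or_ne u 0 with rfl | hu
    · simp
    rcases eq_or_ne v 0 with rfl | hv
    · simp
    have hu' : 0 < ‖u‖ := norm_pos_iff.2 hu
    have hv' : 0 < ‖v‖ := norm_pos_iff.2 hv
    have h1 := norm_le_of_sectorial hM hb (((‖u‖⁻¹ : ℝ) : ℂ) • u) (((‖v‖⁻¹ : ℝ) : ℂ) • v)
    have h2 : ∀ w : E, 0 < ‖w‖ →
        (b (((‖w‖⁻¹ : ℝ) : ℂ) • w) (((‖w‖⁻¹ : ℝ) : ℂ) • w)).re = 1 := fun w hw => by
      simp only [map_smul, LinearMap.smul_apply, map_smulₛₗ, smul_eq_mul, Complex.conj_ofReal,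
        Complex.re_ofReal_mul, ← hnorm]
      field_simp
    rw [h2 u hu', h2 v hv'] at h1
    simp only [map_smul, LinearMap.smul_apply, map_smulₛₗ, smul_eq_mul, Complex.conj_ofReal,
      norm_mul, Complex.norm_real, norm_inv, norm_norm] at h1
    rw [← mul_assoc, ← mul_inv, inv_mul_le_iff₀ (by positivity)] at h1
    linarith
  -- the real bilinear form `Re b + s`, to which the real Lax–Milgram theorem applies
  let B₀ : E →ₗ[ℝ] E →ₗ[ℝ] ℝ := LinearMap.mk₂ ℝ
    (fun u v => (b u v).re + s * (inner ℂ (j v) (j u)).re)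
    (fun u u' v => by
      simp only [map_add, LinearMap.add_apply, inner_add_right, Complex.add_re]
      ring)
    (fun r u v => by
      simp only [← Complex.coe_smul, map_smul, LinearMap.smul_apply, inner_smul_right, smul_eq_mul,
        Complex.re_ofReal_mul]
      ring)
    (fun u v v' => by
      simp only [map_add, inner_add_left, Complex.add_re]
      ring)
    (fun r u v => by
      simp only [← Complex.coe_smul, map_smul, map_smulₛₗ, inner_smul_left, smul_eq_mul,
        Complex.conj_ofReal, Complex.re_ofReal_mul]
      ring)
  have hinner : ∀ u v : E, |(inner ℂ (j v) (j u)).re| ≤ ‖u‖ * ‖v‖ := fun u v => by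
    refine (Complex.abs_re_le_norm _).trans ((norm_inner_le_norm _ _).trans ?_)
    rw [mul_comm]
    exact mul_le_mul (hjn u) (hjn v) (norm_nonneg _) (norm_nonneg _)
  let B : E →L[ℝ] E →L[ℝ] ℝ := B₀.mkContinuous₂ (2 * (1 + M) + s) fun u v => by
    change |(b u v).re + s * (inner ℂ (j v) (j u)).re| ≤ _
    refine (abs_add_le _ _).trans ?_
    rw [abs_mul, abs_of_nonneg hs]
    have h1 := (Complex.abs_re_le_norm (b u v)).trans (hbound u v)
    have h2 := mul_le_mul_of_nonneg_left (hinner u v) hs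
    linarith
  have hB : ∀ u v, B u v = (b u v).re + s * (inner ℂ (j v) (j u)).re := fun u v => rfl
  have hcoercive : IsCoercive B := ⟨1, one_pos, fun u => by
    rw [one_mul, ← sq, hnorm, hB]
    have h1 : 0 ≤ (inner ℂ (j u) (j u)).re := inner_self_nonneg (𝕜 := ℂ)
    linarith [mul_nonneg hs h1]⟩
  let ℓ₀ : E →ₗ[ℝ] ℝ :=
    { toFun := fun v => (inner ℂ (j v) y).re
      map_add' := fun v v' => by simp only [map_add, inner_add_left, Complex.add_re]
      map_smul' := fun r v => by
        simp only [← Complex.coe_smul, map_smul, inner_smul_left, Complex.conj_ofReal,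
          Complex.re_ofReal_mul, RingHom.id_apply, smul_eq_mul] }
  let ℓ : E →L[ℝ] ℝ := ℓ₀.mkContinuous ‖y‖ fun v => by
    refine (Complex.abs_re_le_norm _).trans ((norm_inner_le_norm _ _).trans ?_)
    rw [mul_comm]
    exact mul_le_mul_of_nonneg_left (hjn v) (norm_nonneg _)
  set u := hcoercive.continuousLinearEquivOfBilin.symm
    ((InnerProductSpace.toDual ℝ E).symm ℓ) with hu
  have hsol : ∀ v, (b u v).re + s * (inner ℂ (j v) (j u)).re = (inner ℂ (j v) y).re := fun v => by
    have h1 := hcoercive.continuousLinearEquivOfBilin_apply u v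
    rw [hu, ContinuousLinearEquiv.apply_symm_apply, ← hu,
      InnerProductSpace.toDual_symm_apply] at h1
    rw [← hB, ← h1]
    rfl
  refine ⟨u, fun v => Complex.ext ?_ ?_⟩
  · rw [← hsol v, Complex.add_re, Complex.re_ofReal_mul]
  · -- both sides are conjugate linear in `v`: test with `I • v`
    have h1 := hsol (Complex.I • v)
    simp only [map_smul, map_smulₛₗ, inner_smul_left, smul_eq_mul, Complex.conj_I,
      Complex.mul_re, Complex.neg_re, Complex.neg_im, Complex.I_re, Complex.I_im] at h1
    rw [Complex.add_im, Complex.im_ofReal_mul]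
    linarith

end LaxMilgram

open scoped ContDiff

/-! ### Bounded weighted forms on `L²` -/

section Weighted

variable {d m : ℕ}

theorem norm_sq_eq_integral (u : L2 d m) : ‖u‖ ^ 2 = ∫ x, ‖u x‖ ^ 2 := by
  have h1 : ((‖u‖ ^ 2 : ℝ) : ℂ) = ((∫ x, ‖u x‖ ^ 2 : ℝ) : ℂ) := by
    have := inner_self_eq_norm_sq_to_K (𝕜 := ℂ) u
    rw [L2.inner_def] at this
    simp only [inner_self_eq_norm_sq_to_K] at this
    rw [← integral_complex_ofReal]
    push_cast
    exact this.symm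
  exact_mod_cast h1

theorem integrable_norm_sq (u : L2 d m) : Integrable (fun x => ‖u x‖ ^ 2) volume :=
  (memLp_two_iff_integrable_sq_norm (Lp.memLp u).1).1 (Lp.memLp u)

theorem memLp_component (u : L2 d m) (i : Fin m) : MemLp (fun x => u x i) 2 volume :=
  (Lp.memLp u).eval_piLp i

theorem integrable_component_mul (u v : L2 d m) (i j : Fin m) :
    Integrable (fun x => u x j * conj (v x i)) volume :=
  (memLp_component u j).integrable_mul (memLp_component v i).star

theorem exists_ae_bound_of_memLp_top {β : Rd d → ℝ} (hβ : MemLp β ⊤ volume) :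
    ∃ K : ℝ, 0 ≤ K ∧ ∀ᵐ x, ‖(β x : ℂ)‖ ≤ K := by
  refine ⟨(eLpNorm β ⊤ volume).toReal, ENNReal.toReal_nonneg, ?_⟩
  filter_upwards [ae_le_eLpNormEssSup (f := β) (μ := (volume : Measure (Rd d)))] with x hx
  rw [← eLpNorm_exponent_top] at hx
  rw [Complex.norm_real, ← toReal_enorm]
  exact ENNReal.toReal_mono hβ.2.ne hx

theorem integrable_weight_mul {β : Rd d → ℝ} (hβ : MemLp β ⊤ volume) (u v : L2 d m)
    (i j : Fin m) : Integrable (fun x => (β x : ℂ) * (u x j * conj (v x i))) volume := by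
  obtain ⟨K, -, hK⟩ := exists_ae_bound_of_memLp_top hβ
  exact (integrable_component_mul u v i j).bdd_mul
    (Complex.continuous_ofReal.comp_aestronglyMeasurable hβ.1) hK

/-- The bounded sesquilinear form `∫ β u_j conj(v_i)` on `L²`, for a weight `β ∈ L^∞`. -/
def weightForm {β : Rd d → ℝ} (hβ : MemLp β ⊤ volume) (i j : Fin m) :
    L2 d m →ₗ[ℂ] L2 d m →ₗ⋆[ℂ] ℂ :=
  LinearMap.mk₂'ₛₗ _ _ (fun u v => ∫ x, (β x : ℂ) * (u x j * conj (v x i)))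
    (fun u u' v => by
      rw [← integral_add (integrable_weight_mul hβ u v i j) (integrable_weight_mul hβ u' v i j)]
      refine integral_congr_ae ?_
      filter_upwards [Lp.coeFn_add u u'] with x hx
      rw [hx, Pi.add_apply, PiLp.add_apply]
      ring)
    (fun a u v => by
      rw [RingHom.id_apply, smul_eq_mul, ← integral_const_mul]
      refine integral_congr_ae ?_
      filter_upwards [Lp.coeFn_smul a u] with x hx
      rw [hx, Pi.smul_apply, PiLp.smul_apply, smul_eq_mul]
      ring)
    (fun u v v' => by
      rw [← integral_add (integrable_weight_mul hβ u v i j) (integrable_weight_mul hβ u v' i j)]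
      refine integral_congr_ae ?_
      filter_upwards [Lp.coeFn_add v v'] with x hx
      rw [hx, Pi.add_apply, PiLp.add_apply, map_add]
      ring)
    (fun a u v => by
      rw [smul_eq_mul, ← integral_const_mul]
      refine integral_congr_ae ?_
      filter_upwards [Lp.coeFn_smul a v] with x hx
      rw [hx, Pi.smul_apply, PiLp.smul_apply, smul_eq_mul, map_mul]
      ring)

theorem weightForm_apply {β : Rd d → ℝ} (hβ : MemLp β ⊤ volume) (i j : Fin m) (u v : L2 d m) :
    weightForm hβ i j u v = ∫ x, (β x : ℂ) * (u x j * conj (v x i)) := rfl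

/-- Young's inequality for `weightForm`. -/
theorem exists_norm_weightForm_le {β : Rd d → ℝ} (hβ : MemLp β ⊤ volume) (i j : Fin m) :
    ∃ K : ℝ, 0 ≤ K ∧ ∀ t > 0, ∀ u v : L2 d m,
      ‖weightForm hβ i j u v‖ ≤ K * (t * ‖u‖ ^ 2 + t⁻¹ * ‖v‖ ^ 2) := by
  obtain ⟨K, hK0, hK⟩ := exists_ae_bound_of_memLp_top hβ
  refine ⟨K, hK0, fun t ht u v => ?_⟩
  rw [weightForm_apply, norm_sq_eq_integral, norm_sq_eq_integral, ← integral_const_mul,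
    ← integral_const_mul, ← integral_add ((integrable_norm_sq u).const_mul _)
      ((integrable_norm_sq v).const_mul _), ← integral_const_mul]
  refine norm_integral_le_of_norm_le ((((integrable_norm_sq u).const_mul _).add
    ((integrable_norm_sq v).const_mul _)).const_mul _) ?_
  filter_upwards [hK] with x hx
  rw [norm_mul, norm_mul, RCLike.norm_conj]
  have h1 : ‖u x j‖ ≤ ‖u x‖ := PiLp.norm_apply_le _ _
  have h2 : ‖v x i‖ ≤ ‖v x‖ := PiLp.norm_apply_le _ _
  have h3 : ‖u x j‖ * ‖v x i‖ ≤ ‖u x‖ * ‖v x‖ := by gcongr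
  have h4 : ‖u x‖ * ‖v x‖ ≤ t * ‖u x‖ ^ 2 + t⁻¹ * ‖v x‖ ^ 2 := by
    have h5 : 0 ≤ t⁻¹ * (t * ‖u x‖ - ‖v x‖) ^ 2 := by positivity
    have h6 : t⁻¹ * (t * ‖u x‖ - ‖v x‖) ^ 2
        = t * ‖u x‖ ^ 2 + t⁻¹ * ‖v x‖ ^ 2 - 2 * (‖u x‖ * ‖v x‖) := by
      field_simp
      ring
    nlinarith [mul_nonneg (norm_nonneg (u x)) (norm_nonneg (v x))]
  exact mul_le_mul hx (h3.trans h4) (by positivity) hK0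

end Weighted

/-! ### Weak derivatives -/

section WeakDerivatives

variable {d m : ℕ}

theorem continuous_fderiv_unitVec {F : Type*} [NormedAddCommGroup F] [NormedSpace ℝ F]
    {φ : Rd d → F} (hφ : ContDiff ℝ ∞ φ) (k : Fin d) :
    Continuous fun x => fderiv ℝ φ x (unitVec k) :=
  (hφ.continuous_fderiv (by simp)).clm_apply continuous_const

theorem hasCompactSupport_fderiv_unitVec {F : Type*} [NormedAddCommGroup F] [NormedSpace ℝ F]
    {φ : Rd d → F} (hc : HasCompactSupport φ) (k : Fin d) :
    HasCompactSupport fun x => fderiv ℝ φ x (unitVec k) :=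
  hc.fderiv_apply (𝕜 := ℝ) _

/-- Integration against a test function, as a continuous map on `L²`. -/
def testFunctional {ψ : Rd d → ℝ} (hψ : Continuous ψ) (hc : HasCompactSupport ψ) :
    L2 d m →L[ℝ] EuclideanSpace ℂ (Fin m) :=
  (ContinuousLinearMap.lsmul ℝ ℝ).lpPairing volume 2 2
    ((hψ.memLp_of_hasCompactSupport hc (p := 2) (μ := volume)).toLp ψ)

theorem testFunctional_apply {ψ : Rd d → ℝ} (hψ : Continuous ψ) (hc : HasCompactSupport ψ)
    (f : L2 d m) : testFunctional hψ hc f = ∫ x, ψ x • f x := by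
  rw [testFunctional, ContinuousLinearMap.lpPairing_eq_integral]
  refine integral_congr_ae ?_
  filter_upwards [(hψ.memLp_of_hasCompactSupport hc (p := 2) (μ := volume)).coeFn_toLp] with x hx
  rw [hx]
  rfl

theorem hasWeakDeriv_iff_testFunctional {k : Fin d} {f g : L2 d m} :
    HasWeakDeriv k f g ↔ ∀ (φ : Rd d → ℝ) (hφ : ContDiff ℝ ∞ φ) (hc : HasCompactSupport φ),
      testFunctional (continuous_fderiv_unitVec hφ k) (hasCompactSupport_fderiv_unitVec hc k) f
        = -testFunctional hφ.continuous hc g := by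
  simp only [testFunctional_apply]
  rfl

theorem HasWeakDeriv.add {k : Fin d} {f f' g g' : L2 d m} (h : HasWeakDeriv k f g)
    (h' : HasWeakDeriv k f' g') : HasWeakDeriv k (f + f') (g + g') := by
  rw [hasWeakDeriv_iff_testFunctional] at *
  intro φ hφ hc
  rw [map_add, map_add, h φ hφ hc, h' φ hφ hc, neg_add]

theorem HasWeakDeriv.smul {k : Fin d} {f g : L2 d m} (a : ℂ) (h : HasWeakDeriv k f g) :
    HasWeakDeriv k (a • f) (a • g) := by
  intro φ hφ hc
  have e : ∀ (ψ : Rd d → ℝ) (u : L2 d m), ∫ x, ψ x • (a • u) x = a • ∫ x, ψ x • u x := by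
    intro ψ u
    rw [← integral_smul]
    refine integral_congr_ae ?_
    filter_upwards [Lp.coeFn_smul a u] with x hx
    rw [hx, Pi.smul_apply, smul_comm]
  rw [e (fun x => fderiv ℝ φ x (unitVec k)) f, e φ g, h φ hφ hc, smul_neg]

/-- The weak derivative is a closed operator. -/
theorem HasWeakDeriv.of_tendsto {k : Fin d} {f g : ℕ → L2 d m} {f₀ g₀ : L2 d m}
    (h : ∀ n, HasWeakDeriv k (f n) (g n)) (hf : Tendsto f atTop (𝓝 f₀))
    (hg : Tendsto g atTop (𝓝 g₀)) : HasWeakDeriv k f₀ g₀ := by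
  simp only [hasWeakDeriv_iff_testFunctional] at *
  intro φ hφ hc
  refine tendsto_nhds_unique (((ContinuousLinearMap.continuous _).tendsto _).comp hf) ?_
  refine ((((ContinuousLinearMap.continuous _).tendsto _).comp hg).neg).congr fun n => ?_
  exact (h n φ hφ hc).symm

theorem MemH1.hasWeakDeriv {f : L2 d m} (hf : MemH1 f) (k : Fin d) :
    HasWeakDeriv k f (weakDeriv k f) :=
  (hasWeakDeriv_iff (hf k)).2 rfl

theorem HasWeakDeriv.weakDeriv_eq {k : Fin d} {f g : L2 d m} (h : HasWeakDeriv k f g) :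
    weakDeriv k f = g :=
  (hasWeakDeriv_iff ⟨g, h⟩).1 h

end WeakDerivatives

/-! ### Test functions in `L²` -/

section TestFunctions

variable {d m : ℕ}

/-- The class in `L²` of a continuous compactly supported function. -/
def testLp {φ : Rd d → EuclideanSpace ℂ (Fin m)} (hφ : Continuous φ)
    (hc : HasCompactSupport φ) : L2 d m :=
  (hφ.memLp_of_hasCompactSupport hc (p := 2) (μ := volume)).toLp φ

theorem coeFn_testLp {φ : Rd d → EuclideanSpace ℂ (Fin m)} (hφ : Continuous φ)
    (hc : HasCompactSupport φ) : testLp hφ hc =ᵐ[volume] φ :=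
  MemLp.coeFn_toLp _

/-- The weak derivative of a test function is its classical derivative. -/
theorem hasWeakDeriv_testLp {φ : Rd d → EuclideanSpace ℂ (Fin m)} (hφ : ContDiff ℝ ∞ φ)
    (hc : HasCompactSupport φ) (k : Fin d) :
    HasWeakDeriv k (testLp hφ.continuous hc)
      (testLp (continuous_fderiv_unitVec hφ k) (hasCompactSupport_fderiv_unitVec hc k)) := by
  intro ψ hψ hψc
  have e1 : ∫ x, (fderiv ℝ ψ x (unitVec k)) • (testLp hφ.continuous hc) x
      = ∫ x, (fderiv ℝ ψ x (unitVec k)) • φ x := by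
    refine integral_congr_ae ?_
    filter_upwards [coeFn_testLp hφ.continuous hc] with x hx
    rw [hx]
  have e2 : ∫ x, ψ x • (testLp (continuous_fderiv_unitVec hφ k)
      (hasCompactSupport_fderiv_unitVec hc k)) x = ∫ x, ψ x • fderiv ℝ φ x (unitVec k) := by
    refine integral_congr_ae ?_
    filter_upwards [coeFn_testLp (continuous_fderiv_unitVec hφ k)
      (hasCompactSupport_fderiv_unitVec hc k)] with x hx
    rw [hx]
  rw [e1, e2, integral_smul_fderiv_eq_neg_fderiv_smul_of_integrable (𝕜 := ℝ), neg_neg]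
  · exact ((continuous_fderiv_unitVec hψ k).smul hφ.continuous).integrable_of_hasCompactSupport
      hc.smul_left
  · exact (hψ.continuous.smul (continuous_fderiv_unitVec hφ k)).integrable_of_hasCompactSupport
      hψc.smul_right
  · exact (hψ.continuous.smul hφ.continuous).integrable_of_hasCompactSupport hc.smul_left
  · exact fun x _ => (hψ.differentiable (by simp)).differentiableAt
  · exact fun x _ => (hφ.differentiable (by simp)).differentiableAt

/-- Test functions are dense: a function orthogonal to all of them vanishes. -/
theorem eq_zero_of_forall_inner_testLp_eq_zero {g : L2 d m}
    (hg : ∀ (φ : Rd d → EuclideanSpace ℂ (Fin m)) (hφ : ContDiff ℝ ∞ φ)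
      (hc : HasCompactSupport φ), inner ℂ (testLp hφ.continuous hc) g = 0) : g = 0 := by
  have hloc : LocallyIntegrable (fun x => g x) (volume : Measure (Rd d)) :=
    (Lp.memLp g).locallyIntegrable (by norm_num)
  refine Lp.ext ?_
  have h0 : ∀ᵐ x, g x = 0 := by
    refine ae_eq_zero_of_integral_contDiff_smul_eq_zero hloc fun ψ hψ hψc => ?_
    refine ext_inner_left ℂ fun v => ?_
    have h1 := hg (fun x => ψ x • v) (hψ.smul contDiff_const) hψc.smul_right
    rw [L2.inner_def] at h1
    rw [inner_zero_right, ← integral_inner (hloc.integrable_smul_left_of_hasCompactSupport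
      hψ.continuous hψc), ← h1]
    refine integral_congr_ae ?_
    filter_upwards [coeFn_testLp (φ := fun x => ψ x • v) (hψ.smul contDiff_const).continuous
      hψc.smul_right] with x hx
    rw [hx, ← Complex.coe_smul, ← Complex.coe_smul, inner_smul_left, inner_smul_right,
      Complex.conj_ofReal]
  filter_upwards [h0, Lp.coeFn_zero (EuclideanSpace ℂ (Fin m)) 2 (volume : Measure (Rd d))]
    with x hx hx0
  rw [hx, hx0, Pi.zero_apply]

end TestFunctions

/-! ### The pairing of a real matrix with complex vectors -/

section Pairing

variable {n : ℕ}

/-- `pairing A` as a sesquilinear map. -/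
def pairingForm (A : Matrix (Fin n) (Fin n) ℝ) : (Fin n → ℂ) →ₗ[ℂ] (Fin n → ℂ) →ₗ⋆[ℂ] ℂ :=
  LinearMap.mk₂'ₛₗ _ _ (pairing A)
    (fun ξ ξ' ζ => by
      simp only [pairing, Pi.add_apply, mul_add, add_mul, Finset.sum_add_distrib])
    (fun a ξ ζ => by
      simp only [pairing, Pi.smul_apply, smul_eq_mul, RingHom.id_apply, Finset.mul_sum,
        Finset.sum_mul]
      exact Finset.sum_congr rfl fun i _ => Finset.sum_congr rfl fun j _ => by ring)
    (fun ξ ζ ζ' => by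
      simp only [pairing, Pi.add_apply, map_add, mul_add, Finset.sum_add_distrib])
    (fun a ξ ζ => by
      simp only [pairing, Pi.smul_apply, smul_eq_mul, map_mul, Finset.mul_sum,
        Finset.sum_mul]
      exact Finset.sum_congr rfl fun i _ => Finset.sum_congr rfl fun j _ => by ring)

theorem pairingForm_apply (A : Matrix (Fin n) (Fin n) ℝ) (ξ ζ : Fin n → ℂ) :
    pairingForm A ξ ζ = pairing A ξ ζ := rfl

theorem pairing_eq_sum (A : Matrix (Fin n) (Fin n) ℝ) (ξ ζ : Fin n → ℂ) :
    pairing A ξ ζ = ∑ i, ∑ j, (A i j : ℂ) * (ξ j * conj (ζ i)) := by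
  simp only [pairing, Finset.sum_mul, mul_assoc]

theorem pairing_transpose (A : Matrix (Fin n) (Fin n) ℝ) (ξ : Fin n → ℂ) :
    pairing A.transpose ξ ξ = conj (pairing A ξ ξ) := by
  rw [pairing_eq_sum, pairing_eq_sum, Finset.sum_comm]
  simp only [map_sum, map_mul, Complex.conj_ofReal, Complex.conj_conj, Matrix.transpose_apply]
  exact Finset.sum_congr rfl fun i _ => Finset.sum_congr rfl fun j _ => by ring

theorem pairing_self_im_of_isSymm {A : Matrix (Fin n) (Fin n) ℝ} (hA : A.IsSymm)
    (ξ : Fin n → ℂ) : (pairing A ξ ξ).im = 0 := by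
  have := pairing_transpose A ξ
  rw [hA.eq] at this
  exact Complex.conj_eq_iff_im.1 this.symm

theorem pairing_self_re (A : Matrix (Fin n) (Fin n) ℝ) (ξ : Fin n → ℂ) :
    (pairing A ξ ξ).re = (∑ i, (∑ j, A i j * (ξ j).re) * (ξ i).re)
      + ∑ i, (∑ j, A i j * (ξ j).im) * (ξ i).im := by
  rw [pairing_eq_sum]
  simp only [Complex.re_sum, Complex.mul_re, Complex.mul_im, Complex.ofReal_re,
    Complex.ofReal_im, Complex.conj_re, Complex.conj_im, Finset.sum_mul, ← Finset.sum_add_distrib]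
  exact Finset.sum_congr rfl fun i _ => Finset.sum_congr rfl fun j _ => by ring

variable {d m : ℕ}

theorem pairing_Vs (c : Coefficients d m) (x : Rd d) (ξ : Fin m → ℂ) :
    pairing (c.Vs x) ξ ξ = ((pairing (c.V x) ξ ξ).re : ℂ) := by
  have h1 : pairing (c.Vs x) ξ ξ
      = (1 / 2 : ℂ) * (pairing (c.V x) ξ ξ + pairing (c.V x).transpose ξ ξ) := by
    simp only [pairing_eq_sum, Coefficients.Vs, Matrix.smul_apply, Matrix.add_apply, smul_eq_mul,
      ← Finset.sum_add_distrib, Finset.mul_sum]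
    refine Finset.sum_congr rfl fun i _ => Finset.sum_congr rfl fun j _ => ?_
    push_cast
    ring
  rw [h1, pairing_transpose, Complex.add_conj]
  push_cast
  ring

end Pairing

/-! ### The form domain and the potential -/

section FormDomain

variable {d m : ℕ} {c : Coefficients d m}

theorem aestronglyMeasurable_V (hc : Hypotheses c) (i j : Fin m) :
    AEStronglyMeasurable (fun x => (c.V x i j : ℂ)) volume :=
  Complex.continuous_ofReal.comp_aestronglyMeasurable
    (hc.locallyIntegrable_V i j).aestronglyMeasurable

theorem aestronglyMeasurable_pairing_V (hc : Hypotheses c) (f g : L2 d m) :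
    AEStronglyMeasurable (fun x => pairing (c.V x) (f x) (g x)) volume := by
  simp only [pairing_eq_sum]
  refine Finset.aestronglyMeasurable_fun_sum _ fun i _ =>
    Finset.aestronglyMeasurable_fun_sum _ fun j _ => ?_
  exact (aestronglyMeasurable_V hc i j).mul (integrable_component_mul f g i j).1

/-- `⟨V f, g⟩` is integrable for `f`, `g` in the form domain, since `V` is sectorial. -/
theorem integrable_pairing_V (hc : Hypotheses c) {f g : L2 d m}
    (hf : Integrable (fun x => pairing (c.Vs x) (f x) (f x)) volume)
    (hg : Integrable (fun x => pairing (c.Vs x) (g x) (g x)) volume) :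
    Integrable (fun x => pairing (c.V x) (f x) (g x)) volume := by
  obtain ⟨M, hM, hV⟩ := hc.sectorial_V
  refine Integrable.mono' ((hf.re.add hg.re).const_mul (1 + M))
    (aestronglyMeasurable_pairing_V hc f g) (Eventually.of_forall fun x => ?_)
  have := norm_le_of_sectorial (b := pairingForm (c.V x)) hM (hV x) (f x) (g x)
  simpa [pairing_Vs, pairingForm_apply] using this

theorem memFormDomain_iff (hc : Hypotheses c) {f : L2 d m} : MemFormDomain c f ↔
    MemH1 f ∧ Integrable (fun x => pairing (c.V x) (f x) (f x)) volume := by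
  refine and_congr_right fun _ => ⟨fun h => integrable_pairing_V hc h h, fun h => ?_⟩
  simp only [pairing_Vs]
  exact h.re.ofReal

theorem pairing_coeFn_add_left (A : Rd d → Matrix (Fin m) (Fin m) ℝ) (f f' g : L2 d m) :
    (fun x => pairing (A x) ((f + f' : L2 d m) x) (g x))
      =ᵐ[volume] fun x => pairing (A x) (f x) (g x) + pairing (A x) (f' x) (g x) := by
  filter_upwards [Lp.coeFn_add f f'] with x hx
  simp only [hx, Pi.add_apply, ← pairingForm_apply, WithLp.ofLp_add, map_add,
    LinearMap.add_apply]

theorem pairing_coeFn_add_right (A : Rd d → Matrix (Fin m) (Fin m) ℝ) (f g g' : L2 d m) :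
    (fun x => pairing (A x) (f x) ((g + g' : L2 d m) x))
      =ᵐ[volume] fun x => pairing (A x) (f x) (g x) + pairing (A x) (f x) (g' x) := by
  filter_upwards [Lp.coeFn_add g g'] with x hx
  simp only [hx, Pi.add_apply, ← pairingForm_apply, WithLp.ofLp_add, map_add]

theorem pairing_coeFn_smul_left (A : Rd d → Matrix (Fin m) (Fin m) ℝ) (a : ℂ) (f g : L2 d m) :
    (fun x => pairing (A x) ((a • f : L2 d m) x) (g x))
      =ᵐ[volume] fun x => a * pairing (A x) (f x) (g x) := by
  filter_upwards [Lp.coeFn_smul a f] with x hx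
  simp only [hx, Pi.smul_apply, ← pairingForm_apply, WithLp.ofLp_smul, map_smul,
    LinearMap.smul_apply, smul_eq_mul]

theorem pairing_coeFn_smul_right (A : Rd d → Matrix (Fin m) (Fin m) ℝ) (a : ℂ) (f g : L2 d m) :
    (fun x => pairing (A x) (f x) ((a • g : L2 d m) x))
      =ᵐ[volume] fun x => conj a * pairing (A x) (f x) (g x) := by
  filter_upwards [Lp.coeFn_smul a g] with x hx
  simp only [hx, Pi.smul_apply, ← pairingForm_apply, WithLp.ofLp_smul, map_smulₛₗ,
    smul_eq_mul]

/-- The form domain `D(a)` as a subspace of `L²`. -/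
def formDomain (hc : Hypotheses c) : Submodule ℂ (L2 d m) where
  carrier := {f | MemFormDomain c f}
  add_mem' := by
    rintro f g hf hg
    refine (memFormDomain_iff hc).2 ⟨fun k =>
      ⟨_, (hf.1.hasWeakDeriv k).add (hg.1.hasWeakDeriv k)⟩, ?_⟩
    refine (integrable_congr (pairing_coeFn_add_left c.V f g (f + g))).2 (Integrable.add ?_ ?_)
    · exact (integrable_congr (pairing_coeFn_add_right c.V f f g)).2
        ((integrable_pairing_V hc hf.2 hf.2).add (integrable_pairing_V hc hf.2 hg.2))
    · exact (integrable_congr (pairing_coeFn_add_right c.V g f g)).2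
        ((integrable_pairing_V hc hg.2 hf.2).add (integrable_pairing_V hc hg.2 hg.2))
  zero_mem' := by
    refine (memFormDomain_iff hc).2 ⟨fun k => ⟨0, ?_⟩, ?_⟩
    · simp [hasWeakDeriv_iff_testFunctional]
    · refine (integrable_zero _ ℂ _).congr (Eventually.of_forall fun x => ?_)
      simp [pairing]
  smul_mem' := by
    rintro a f hf
    refine (memFormDomain_iff hc).2 ⟨fun k => ⟨_, (hf.1.hasWeakDeriv k).smul a⟩, ?_⟩
    refine (integrable_congr (pairing_coeFn_smul_left c.V a f (a • f))).2
      (Integrable.const_mul ?_ _)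
    exact (integrable_congr (pairing_coeFn_smul_right c.V a f f)).2
        ((integrable_pairing_V hc hf.2 hf.2).const_mul _)

variable (hc : Hypotheses c)

/-- The weak derivative `∂_k` as a linear map on the form domain. -/
def weakDerivₗ (k : Fin d) : formDomain hc →ₗ[ℂ] L2 d m where
  toFun f := weakDeriv k f
  map_add' f g := ((f.2.1.hasWeakDeriv k).add (g.2.1.hasWeakDeriv k)).weakDeriv_eq
  map_smul' a f := ((f.2.1.hasWeakDeriv k).smul a).weakDeriv_eq

theorem weakDerivₗ_apply (k : Fin d) (f : formDomain hc) :
    weakDerivₗ hc k f = weakDeriv k (f : L2 d m) := rfl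

/-- The potential part `∫ ⟨V f, g⟩` of the form. -/
def potentialForm : formDomain hc →ₗ[ℂ] formDomain hc →ₗ⋆[ℂ] ℂ :=
  LinearMap.mk₂'ₛₗ _ _ (fun f g => ∫ x, pairing (c.V x) ((f : L2 d m) x) ((g : L2 d m) x))
    (fun f f' g => by
      rw [← integral_add (integrable_pairing_V hc f.2.2 g.2.2)
        (integrable_pairing_V hc f'.2.2 g.2.2)]
      exact integral_congr_ae (pairing_coeFn_add_left c.V f f' g))
    (fun a f g => by
      rw [RingHom.id_apply, smul_eq_mul, ← integral_const_mul]
      exact integral_congr_ae (pairing_coeFn_smul_left c.V a f g))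
    (fun f g g' => by
      rw [← integral_add (integrable_pairing_V hc f.2.2 g.2.2)
        (integrable_pairing_V hc f.2.2 g'.2.2)]
      exact integral_congr_ae (pairing_coeFn_add_right c.V f g g'))
    (fun a f g => by
      rw [smul_eq_mul, ← integral_const_mul]
      exact integral_congr_ae (pairing_coeFn_smul_right c.V a f g))

theorem potentialForm_apply (f g : formDomain hc) : potentialForm hc f g
    = ∫ x, pairing (c.V x) ((f : L2 d m) x) ((g : L2 d m) x) := rfl

/-- `V` is sectorial under the integral sign. -/
theorem exists_abs_im_potentialForm_le : ∃ M : ℝ, 0 < M ∧ ∀ f : formDomain hc,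
    0 ≤ (potentialForm hc f f).re ∧
      |(potentialForm hc f f).im| ≤ M * (potentialForm hc f f).re := by
  obtain ⟨M, hM, hV⟩ := hc.sectorial_V
  refine ⟨M, hM, fun f => ?_⟩
  have hint := integrable_pairing_V hc f.2.2 f.2.2
  have hre : (potentialForm hc f f).re = ∫ x, (pairing (c.V x) ((f : L2 d m) x)
      ((f : L2 d m) x)).re := by
    rw [potentialForm_apply]; exact (integral_re hint).symm
  have him : (potentialForm hc f f).im = ∫ x, (pairing (c.V x) ((f : L2 d m) x)
      ((f : L2 d m) x)).im := by
    rw [potentialForm_apply]; exact (integral_im hint).symm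
  rw [hre, him]
  refine ⟨integral_nonneg fun x => re_nonneg_of_sectorial (b := pairingForm (c.V x)) hM (hV x) _,
    ?_⟩
  rw [← integral_const_mul]
  exact (abs_integral_le_integral_abs).trans
    (integral_mono hint.im.abs (hint.re.const_mul M) fun x => hV x _)

end FormDomain

/-! ### Boundedness of the coefficients -/

section Coefficients

variable {d m : ℕ} {c : Coefficients d m} (hc : Hypotheses c)
include hc

theorem memLp_top_F (i j : Fin m) (k : Fin d) : MemLp (fun x => c.F i j x k) ⊤ volume :=
  (hc.bounded_F i j).eval_piLp k

theorem memLp_top_C (i j : Fin m) (k : Fin d) : MemLp (fun x => c.C i j x k) ⊤ volume :=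
  (hc.bounded_C i j).eval_piLp k

/-- The entries of the symmetric matrix `Q(x)` are bounded by polarization:
`4 q_{kl} = ⟨Q (e_k + e_l), e_k + e_l⟩ - ⟨Q (e_k - e_l), e_k - e_l⟩`. -/
theorem memLp_top_Q (k l : Fin d) : MemLp (fun x => c.Q x k l) ⊤ volume := by
  obtain ⟨η₁, η₂, hη₁, hη₂, hQ⟩ := hc.elliptic_Q
  refine memLp_top_of_bound (hc.measurable_Q k l).aestronglyMeasurable η₂
    (Eventually.of_forall fun x => ?_)
  have hpol : 4 * c.Q x k l
      = (∑ a, (∑ b, c.Q x a b * (unitVec k + unitVec l : Rd d) b)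
          * (unitVec k + unitVec l : Rd d) a)
      - ∑ a, (∑ b, c.Q x a b * (unitVec k - unitVec l : Rd d) b)
          * (unitVec k - unitVec l : Rd d) a := by
    have hs := (hc.symm_Q x).apply k l
    simp only [PiLp.add_apply, PiLp.sub_apply, PiLp.single_apply, mul_add, mul_sub, mul_ite,
      mul_one, mul_zero, Finset.sum_add_distrib, Finset.sum_sub_distrib, Finset.sum_ite_eq',
      Finset.mem_univ, if_true]
    linarith
  have hn : ∀ v : Rd d, ‖v‖ ≤ 2 → 0 ≤ ∑ a, (∑ b, c.Q x a b * v b) * v a ∧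
      ∑ a, (∑ b, c.Q x a b * v b) * v a ≤ 4 * η₂ := fun v hv => by
    have h1 := hQ x v
    have h2 : ‖v‖ ^ 2 ≤ 2 ^ 2 := by gcongr
    exact ⟨(by positivity : 0 ≤ η₁ * ‖v‖ ^ 2).trans h1.1, by nlinarith⟩
  have hu : ∀ k : Fin d, ‖(unitVec k : Rd d)‖ = 1 := fun k => by simp
  have h1 := hn (unitVec k + unitVec l) ((norm_add_le _ _).trans (by rw [hu, hu]; norm_num))
  have h2 := hn (unitVec k - unitVec l) ((norm_sub_le _ _).trans (by rw [hu, hu]; norm_num))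
  rw [Real.norm_eq_abs, abs_le]
  constructor <;> linarith

end Coefficients

/-! ### Sectoriality of the form -/

section FormParts

variable {d m : ℕ} {c : Coefficients d m} (hc : Hypotheses c)

/-- The principal part `∑ i, ∫ ⟨Q ∇f_i, ∇g_i⟩` of the form. -/
def diffusionForm : formDomain hc →ₗ[ℂ] formDomain hc →ₗ⋆[ℂ] ℂ :=
  LinearMap.mk₂'ₛₗ _ _ (fun f g => ∑ i, ∑ k, ∑ l,
      weightForm (memLp_top_Q hc k l) i i (weakDerivₗ hc l f) (weakDerivₗ hc k g))
    (fun f f' g => by simp only [map_add, LinearMap.add_apply, Finset.sum_add_distrib])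
    (fun a f g => by simp only [map_smul, LinearMap.smul_apply, Finset.smul_sum, RingHom.id_apply])
    (fun f g g' => by simp only [map_add, Finset.sum_add_distrib])
    (fun a f g => by simp only [map_smul, map_smulₛₗ, Finset.smul_sum])

/-- The first order part of the form, with the fields `F_{ij}` and `C_{ij}`. -/
def driftForm : formDomain hc →ₗ[ℂ] formDomain hc →ₗ⋆[ℂ] ℂ :=
  LinearMap.mk₂'ₛₗ _ _ (fun f g =>
      (∑ i, ∑ j, ∑ k, weightForm (memLp_top_F hc i j k) i j (weakDerivₗ hc k f) (g : L2 d m))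
      + ∑ i, ∑ j, ∑ k, weightForm (memLp_top_C hc i j k) i j (f : L2 d m) (weakDerivₗ hc k g))
    (fun f f' g => by
      simp only [map_add, LinearMap.add_apply, Finset.sum_add_distrib, Submodule.coe_add]
      abel)
    (fun a f g => by
      simp only [map_smul, LinearMap.smul_apply, Finset.smul_sum, RingHom.id_apply, smul_add,
        Submodule.coe_smul])
    (fun f g g' => by
      simp only [map_add, Finset.sum_add_distrib, Submodule.coe_add]
      abel)
    (fun a f g => by
      simp only [map_smul, map_smulₛₗ, Finset.smul_sum, smul_add, Submodule.coe_smul])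

theorem integral_pairing_Q_eq (f g : formDomain hc) (i : Fin m) :
    ∫ x, pairing (c.Q x) (fun k => weakDeriv k (f : L2 d m) x i)
      (fun k => weakDeriv k (g : L2 d m) x i)
      = ∑ k, ∑ l, weightForm (memLp_top_Q hc k l) i i (weakDerivₗ hc l f) (weakDerivₗ hc k g) := by
  simp only [pairing_eq_sum, weightForm_apply, weakDerivₗ_apply]
  rw [integral_finsetSum _ fun k _ => integrable_finsetSum _ fun l _ =>
    integrable_weight_mul (memLp_top_Q hc k l) _ _ i i]
  refine Finset.sum_congr rfl fun k _ => ?_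
  rw [integral_finsetSum _ fun l _ => integrable_weight_mul (memLp_top_Q hc k l) _ _ i i]

theorem form_eq (f g : formDomain hc) : form c (f : L2 d m) (g : L2 d m)
    = diffusionForm hc f g + driftForm hc f g + potentialForm hc f g := by
  have hF : ∀ i j, ∫ x, (∑ k, (c.F i j x k : ℂ) * weakDeriv k (f : L2 d m) x j)
      * conj ((g : L2 d m) x i)
      = ∑ k, weightForm (memLp_top_F hc i j k) i j (weakDerivₗ hc k f) (g : L2 d m) := by
    intro i j
    simp only [Finset.sum_mul, mul_assoc, weightForm_apply, weakDerivₗ_apply]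
    rw [integral_finsetSum _ fun k _ => integrable_weight_mul (memLp_top_F hc i j k) _ _ i j]
  have hC : ∀ i j, ∫ x, (f : L2 d m) x j
      * ∑ k, (c.C i j x k : ℂ) * conj (weakDeriv k (g : L2 d m) x i)
      = ∑ k, weightForm (memLp_top_C hc i j k) i j (f : L2 d m) (weakDerivₗ hc k g) := by
    intro i j
    simp only [Finset.mul_sum, mul_left_comm ((f : L2 d m) _ j), weightForm_apply,
      weakDerivₗ_apply]
    rw [integral_finsetSum _ fun k _ => integrable_weight_mul (memLp_top_C hc i j k) _ _ i j]
  simp only [form, formIntegral, hF, hC, integral_pairing_Q_eq hc f g]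
  rw [add_assoc (∑ i, ∑ k, ∑ l, _)]
  rfl

/-- The Dirichlet integral `∑ k, ‖∂_k f‖²`. -/
def gradSq (f : formDomain hc) : ℝ := ∑ k, ‖weakDerivₗ hc k f‖ ^ 2

theorem gradSq_nonneg (f : formDomain hc) : 0 ≤ gradSq hc f :=
  Finset.sum_nonneg fun _ _ => sq_nonneg _

theorem norm_weakDeriv_sq_le_gradSq (f : formDomain hc) (k : Fin d) :
    ‖weakDerivₗ hc k f‖ ^ 2 ≤ gradSq hc f :=
  Finset.single_le_sum (f := fun k => ‖weakDerivₗ hc k f‖ ^ 2) (fun _ _ => sq_nonneg _)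
    (Finset.mem_univ k)

theorem gradSq_eq_sum_integral (f : formDomain hc) :
    gradSq hc f = ∑ i, ∫ x, ∑ k, ‖weakDeriv k (f : L2 d m) x i‖ ^ 2 := by
  have hint : ∀ k i, Integrable (fun x => ‖weakDeriv k (f : L2 d m) x i‖ ^ 2) volume :=
    fun k i => (memLp_two_iff_integrable_sq_norm (memLp_component _ i).1).1 (memLp_component _ i)
  simp only [gradSq, norm_sq_eq_integral, weakDerivₗ_apply, EuclideanSpace.norm_sq_eq]
  simp only [integral_finsetSum _ fun i _ => hint _ i, integral_finsetSum _ fun k _ => hint k _]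
  exact Finset.sum_comm

/-- The principal part is real on the diagonal and comparable with the Dirichlet integral. -/
theorem diffusionForm_bounds : ∃ η₁ η₂ : ℝ, 0 < η₁ ∧ 0 < η₂ ∧ ∀ f : formDomain hc,
    (diffusionForm hc f f).im = 0 ∧ η₁ * gradSq hc f ≤ (diffusionForm hc f f).re ∧
      (diffusionForm hc f f).re ≤ η₂ * gradSq hc f := by
  obtain ⟨η₁, η₂, hη₁, hη₂, hQ⟩ := hc.elliptic_Q
  refine ⟨η₁, η₂, hη₁, hη₂, fun f => ?_⟩
  set ξ : Fin m → Rd d → Fin d → ℂ := fun i x k => weakDeriv k (f : L2 d m) x i with hξ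
  have hform : diffusionForm hc f f = ∑ i, ∫ x, pairing (c.Q x) (ξ i x) (ξ i x) := by
    simp only [hξ, integral_pairing_Q_eq hc f f]
    rfl
  have hint : ∀ i, Integrable (fun x => pairing (c.Q x) (ξ i x) (ξ i x)) volume := fun i => by
    simp only [pairing_eq_sum]
    exact integrable_finsetSum _ fun k _ => integrable_finsetSum _ fun l _ =>
      integrable_weight_mul (memLp_top_Q hc k l) _ _ i i
  have hre : (diffusionForm hc f f).re = ∑ i, ∫ x, (pairing (c.Q x) (ξ i x) (ξ i x)).re := by
    rw [hform, Complex.re_sum]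
    exact Finset.sum_congr rfl fun i _ => (integral_re (hint i)).symm
  have him : (diffusionForm hc f f).im = ∑ i, ∫ x, (pairing (c.Q x) (ξ i x) (ξ i x)).im := by
    rw [hform, Complex.im_sum]
    exact Finset.sum_congr rfl fun i _ => (integral_im (hint i)).symm
  have hgi : ∀ i, Integrable (fun x => ∑ k, ‖ξ i x k‖ ^ 2) volume := fun i =>
    integrable_finsetSum _ fun k _ =>
      (memLp_two_iff_integrable_sq_norm (memLp_component _ i).1).1 (memLp_component _ i)
  -- ellipticity for complex vectors, applied to real and imaginary parts
  have hpt : ∀ (x : Rd d) (ζ : Fin d → ℂ), η₁ * ∑ k, ‖ζ k‖ ^ 2 ≤ (pairing (c.Q x) ζ ζ).re ∧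
      (pairing (c.Q x) ζ ζ).re ≤ η₂ * ∑ k, ‖ζ k‖ ^ 2 := by
    intro x ζ
    have h1 := hQ x (WithLp.toLp 2 fun k => (ζ k).re)
    have h2 := hQ x (WithLp.toLp 2 fun k => (ζ k).im)
    rw [EuclideanSpace.real_norm_sq_eq] at h1 h2
    have hn : ∑ k, ‖ζ k‖ ^ 2 = ∑ k, (ζ k).re ^ 2 + ∑ k, (ζ k).im ^ 2 := by
      rw [← Finset.sum_add_distrib]
      refine Finset.sum_congr rfl fun k _ => ?_
      rw [Complex.sq_norm, Complex.normSq_apply]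
      ring
    rw [pairing_self_re, hn, mul_add, mul_add]
    exact ⟨add_le_add h1.1 h2.1, add_le_add h1.2 h2.2⟩
  refine ⟨?_, ?_, ?_⟩
  · simp [him, pairing_self_im_of_isSymm (hc.symm_Q _)]
  · rw [hre, gradSq_eq_sum_integral, Finset.mul_sum]
    refine Finset.sum_le_sum fun i _ => ?_
    rw [← integral_const_mul]
    exact integral_mono ((hgi i).const_mul _) (hint i).re fun x => (hpt x (ξ i x)).1
  · rw [hre, gradSq_eq_sum_integral, Finset.mul_sum]
    refine Finset.sum_le_sum fun i _ => ?_
    rw [← integral_const_mul]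
    exact integral_mono (hint i).re ((hgi i).const_mul _) fun x => (hpt x (ξ i x)).2

/-- The first order terms are infinitesimally small with respect to the Dirichlet integral. -/
theorem exists_norm_driftForm_le {ε : ℝ} (hε : 0 < ε) : ∃ κ : ℝ, 0 ≤ κ ∧
    ∀ f : formDomain hc, ‖driftForm hc f f‖ ≤ ε * gradSq hc f + κ * ‖(f : L2 d m)‖ ^ 2 := by
  choose K hK0 hK using fun (i j : Fin m) (k : Fin d) =>
    exists_norm_weightForm_le (memLp_top_F hc i j k) i j
  choose K' hK0' hK' using fun (i j : Fin m) (k : Fin d) =>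
    exists_norm_weightForm_le (memLp_top_C hc i j k) i j
  set S := ∑ i, ∑ j, ∑ k, K i j k with hS
  set S' := ∑ i, ∑ j, ∑ k, K' i j k with hS'
  have hS0 : 0 ≤ S := Finset.sum_nonneg fun i _ => Finset.sum_nonneg fun j _ =>
    Finset.sum_nonneg fun k _ => hK0 i j k
  have hS0' : 0 ≤ S' := Finset.sum_nonneg fun i _ => Finset.sum_nonneg fun j _ =>
    Finset.sum_nonneg fun k _ => hK0' i j k
  -- Young's parameter, chosen such that `(S + S') t ≤ ε`
  set t := ε / (S + S' + 1) with ht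
  have ht0 : 0 < t := by positivity
  refine ⟨(S + S') * t⁻¹, by positivity, fun f => ?_⟩
  set N := t * gradSq hc f + t⁻¹ * ‖(f : L2 d m)‖ ^ 2 with hN
  have h1 : ‖∑ i, ∑ j, ∑ k, weightForm (memLp_top_F hc i j k) i j (weakDerivₗ hc k f)
      (f : L2 d m)‖ ≤ S * N := by
    simp only [hS, Finset.sum_mul]
    refine (norm_sum_le _ _).trans (Finset.sum_le_sum fun i _ => ?_)
    refine (norm_sum_le _ _).trans (Finset.sum_le_sum fun j _ => ?_)
    refine (norm_sum_le _ _).trans (Finset.sum_le_sum fun k _ => ?_)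
    refine (hK i j k t ht0 _ _).trans (mul_le_mul_of_nonneg_left ?_ (hK0 i j k))
    have := mul_le_mul_of_nonneg_left (norm_weakDeriv_sq_le_gradSq hc f k) ht0.le
    linarith
  have h2 : ‖∑ i, ∑ j, ∑ k, weightForm (memLp_top_C hc i j k) i j (f : L2 d m)
      (weakDerivₗ hc k f)‖ ≤ S' * N := by
    simp only [hS', Finset.sum_mul]
    refine (norm_sum_le _ _).trans (Finset.sum_le_sum fun i _ => ?_)
    refine (norm_sum_le _ _).trans (Finset.sum_le_sum fun j _ => ?_)
    refine (norm_sum_le _ _).trans (Finset.sum_le_sum fun k _ => ?_)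
    refine (hK' i j k t⁻¹ (inv_pos.2 ht0) _ _).trans (mul_le_mul_of_nonneg_left ?_ (hK0' i j k))
    rw [inv_inv]
    have := mul_le_mul_of_nonneg_left (norm_weakDeriv_sq_le_gradSq hc f k) ht0.le
    linarith
  have h3 : (S + S') * t ≤ ε := by
    rw [ht, mul_div_assoc', div_le_iff₀ (by positivity)]
    nlinarith
  have h4 := mul_le_mul_of_nonneg_right h3 (gradSq_nonneg hc f)
  refine (norm_add_le _ _).trans ((add_le_add h1 h2).trans ?_)
  rw [hN]
  nlinarith

/-- The form `a + κ ⟨·, ·⟩`. -/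
def shiftedForm (κ : ℝ) : formDomain hc →ₗ[ℂ] formDomain hc →ₗ⋆[ℂ] ℂ :=
  LinearMap.mk₂'ₛₗ _ _ (fun f g => (diffusionForm hc f g + driftForm hc f g + potentialForm hc f g)
      + κ * inner ℂ (g : L2 d m) (f : L2 d m))
    (fun f f' g => by
      simp only [map_add, LinearMap.add_apply, Submodule.coe_add, inner_add_right]
      ring)
    (fun a f g => by
      simp only [map_smul, LinearMap.smul_apply, Submodule.coe_smul, inner_smul_right,
        smul_eq_mul, RingHom.id_apply]
      ring)
    (fun f g g' => by
      simp only [map_add, Submodule.coe_add, inner_add_left]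
      ring)
    (fun a f g => by
      simp only [map_smulₛₗ, Submodule.coe_smul, inner_smul_left, smul_eq_mul]
      ring)

theorem shiftedForm_apply (κ : ℝ) (f g : formDomain hc) : shiftedForm hc κ f g
    = form c (f : L2 d m) (g : L2 d m) + κ * inner ℂ (g : L2 d m) (f : L2 d m) := by
  rw [form_eq]
  rfl

/-- The squared form norm `‖f‖² + ‖∇f‖² + ∫ ⟨V_s f, f⟩`. -/
def energy (f : formDomain hc) : ℝ :=
  ‖(f : L2 d m)‖ ^ 2 + gradSq hc f + (potentialForm hc f f).re

/-- For large `κ` the form `a + κ` is sectorial and `Re (a + κ)` is equivalent to the form norm: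
ellipticity absorbs the first order terms. -/
theorem exists_shiftedForm_bounds : ∃ κ M α β : ℝ, 0 ≤ κ ∧ 0 < M ∧ 0 < α ∧ 0 < β ∧
    ∀ f : formDomain hc,
      |(shiftedForm hc κ f f).im| ≤ M * (shiftedForm hc κ f f).re ∧
      ‖(f : L2 d m)‖ ^ 2 ≤ (shiftedForm hc κ f f).re ∧
      α * energy hc f ≤ (shiftedForm hc κ f f).re ∧
      (shiftedForm hc κ f f).re ≤ β * energy hc f := by
  obtain ⟨η₁, η₂, hη₁, hη₂, hQ⟩ := diffusionForm_bounds hc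
  obtain ⟨κ₀, hκ₀, hD⟩ := exists_norm_driftForm_le hc (ε := η₁ / 2) (by positivity)
  obtain ⟨M, hM, hV⟩ := exists_abs_im_potentialForm_le hc
  -- one `κ₀` bounds the real part of the drift terms, the other one their imaginary part, and the
  -- summand `1` yields `‖f‖² ≤ Re (a + κ)(f, f)`
  refine ⟨2 * κ₀ + 1, 1 + M, min (η₁ / 2) 1, η₂ + η₁ / 2 + 3 * κ₀ + 1, by positivity,
    by positivity, by positivity, by positivity, fun f => ?_⟩
  obtain ⟨hQ0, hQ1, hQ2⟩ := hQ f
  obtain ⟨hV0, hV1⟩ := hV f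
  have hD0 := hD f
  have hDre := (Complex.abs_re_le_norm _).trans hD0
  have hDim := (Complex.abs_im_le_norm _).trans hD0
  have hinner : inner ℂ (f : L2 d m) (f : L2 d m) = ((‖(f : L2 d m)‖ ^ 2 : ℝ) : ℂ) := by
    rw [inner_self_eq_norm_sq_to_K]
    norm_cast
  have happ : shiftedForm hc (2 * κ₀ + 1) f f
      = diffusionForm hc f f + driftForm hc f f + potentialForm hc f f
        + ((2 * κ₀ + 1 : ℝ) : ℂ) * ((‖(f : L2 d m)‖ ^ 2 : ℝ) : ℂ) := by
    rw [← hinner]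
    rfl
  have hre : (shiftedForm hc (2 * κ₀ + 1) f f).re
      = (diffusionForm hc f f).re + (driftForm hc f f).re + (potentialForm hc f f).re
        + (2 * κ₀ + 1) * ‖(f : L2 d m)‖ ^ 2 := by
    rw [happ, Complex.add_re, Complex.add_re, Complex.add_re, Complex.re_ofReal_mul,
      Complex.ofReal_re]
  have him : (shiftedForm hc (2 * κ₀ + 1) f f).im
      = (driftForm hc f f).im + (potentialForm hc f f).im := by
    rw [happ, Complex.add_im, Complex.add_im, Complex.add_im, Complex.im_ofReal_mul,
      Complex.ofReal_im, hQ0]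
    ring
  have hG := gradSq_nonneg hc f
  set G := gradSq hc f with hGdef
  set N := ‖(f : L2 d m)‖ ^ 2 with hNdef
  have hN : 0 ≤ N := sq_nonneg _
  set P := (potentialForm hc f f).re with hP
  have hκN : 0 ≤ κ₀ * N := mul_nonneg hκ₀ hN
  have hηG : 0 ≤ η₁ * G := mul_nonneg hη₁.le hG
  have hDre' := abs_le.1 hDre
  have hlow : η₁ / 2 * G + κ₀ * N + N + P ≤ (shiftedForm hc (2 * κ₀ + 1) f f).re := by
    rw [hre]
    linarith [hDre'.1]
  refine ⟨?_, by linarith, ?_, ?_⟩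
  · rw [him]
    refine (abs_add_le _ _).trans ?_
    have h1 : M * P ≤ M * (shiftedForm hc (2 * κ₀ + 1) f f).re :=
      mul_le_mul_of_nonneg_left (by linarith) hM.le
    linarith
  · have h1 := mul_le_mul_of_nonneg_right (min_le_left (η₁ / 2) 1) hG
    have h2 := mul_le_mul_of_nonneg_right (min_le_right (η₁ / 2) 1) hN
    have h3 := mul_le_mul_of_nonneg_right (min_le_right (η₁ / 2) 1) hV0
    rw [energy]
    linarith
  · rw [hre, energy]
    have h1 : 0 ≤ η₂ * N := mul_nonneg hη₂.le hN
    have h2 : 0 ≤ η₁ * N := mul_nonneg hη₁.le hN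
    have h3 : 0 ≤ η₂ * P := mul_nonneg hη₂.le hV0
    have h4 : 0 ≤ η₁ * P := mul_nonneg hη₁.le hV0
    have h5 : 0 ≤ κ₀ * P := mul_nonneg hκ₀ hV0
    have h6 : 0 ≤ κ₀ * G := mul_nonneg hκ₀ hG
    linarith [hDre'.2]

end FormParts

/-! ### Closedness of the form -/

section Closedness

variable {d m : ℕ} {c : Coefficients d m} (hc : Hypotheses c)

theorem lintegral_re_pairing_V (f : formDomain hc) :
    ∫⁻ x, ENNReal.ofReal (pairing (c.V x) ((f : L2 d m) x) ((f : L2 d m) x)).re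
      = ENNReal.ofReal (potentialForm hc f f).re := by
  obtain ⟨M, hM, hV⟩ := hc.sectorial_V
  have hint := integrable_pairing_V hc f.2.2 f.2.2
  have hre : (potentialForm hc f f).re = ∫ x, (pairing (c.V x) ((f : L2 d m) x)
      ((f : L2 d m) x)).re := by
    rw [potentialForm_apply]; exact (integral_re hint).symm
  rw [hre]
  exact (ofReal_integral_eq_lintegral_ofReal hint.re (Eventually.of_forall fun x =>
    re_nonneg_of_sectorial (b := pairingForm (c.V x)) hM (hV x) _)).symm

/-- Lower semicontinuity of the potential part under convergence in `L²`, by Fatou's lemma along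
an almost everywhere convergent subsequence. -/
theorem exists_mem_formDomain_of_tendsto {u : ℕ → formDomain hc} {f : L2 d m} (hf : MemH1 f)
    (hu : Tendsto (fun n => (u n : L2 d m)) atTop (𝓝 f)) {C : ℝ}
    (hC : ∀ᶠ n in atTop, (potentialForm hc (u n) (u n)).re ≤ C) :
    ∃ h : f ∈ formDomain hc, (potentialForm hc ⟨f, h⟩ ⟨f, h⟩).re ≤ C := by
  obtain ⟨M, hM, hV⟩ := hc.sectorial_V
  obtain ⟨ns, hns, hae⟩ := (tendstoInMeasure_of_tendsto_Lp hu).exists_seq_tendsto_ae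
  have hC0 : 0 ≤ C := by
    obtain ⟨n, hn⟩ := hC.exists
    obtain ⟨_, -, hpos⟩ := exists_abs_im_potentialForm_le hc
    exact (hpos (u n)).1.trans hn
  set q : (Rd d → EuclideanSpace ℂ (Fin m)) → Rd d → ENNReal :=
    fun g x => ENNReal.ofReal (pairing (c.V x) (g x) (g x)).re with hq
  have hlim : ∀ᵐ x, liminf (fun i => q (u (ns i) : L2 d m) x) atTop = q f x := by
    filter_upwards [hae] with x hx
    have hcont : Continuous fun ξ : EuclideanSpace ℂ (Fin m) => pairing (c.V x) ξ ξ := by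
      unfold pairing
      fun_prop
    exact ((ENNReal.continuous_ofReal.tendsto _).comp
      ((Complex.continuous_re.tendsto _).comp ((hcont.tendsto _).comp hx))).liminf_eq
  have hfatou : ∫⁻ x, q f x ≤ ENNReal.ofReal C := by
    rw [← lintegral_congr_ae hlim]
    refine (lintegral_liminf_le' fun i =>
      (aestronglyMeasurable_pairing_V hc _ _).re.aemeasurable.ennreal_ofReal).trans ?_
    have hev : ∀ᶠ i in atTop, ∫⁻ x, q (u (ns i) : L2 d m) x ≤ ENNReal.ofReal C := by
      filter_upwards [hns.tendsto_atTop.eventually hC] with i hi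
      exact (lintegral_re_pairing_V hc (u (ns i))).trans_le (ENNReal.ofReal_le_ofReal hi)
    exact (liminf_le_liminf hev).trans_eq (by simp)
  have hmem : f ∈ formDomain hc := by
    refine ⟨hf, ?_⟩
    simp only [pairing_Vs]
    refine Integrable.ofReal ⟨(aestronglyMeasurable_pairing_V hc f f).re, ?_⟩
    exact (hasFiniteIntegral_iff_ofReal (Eventually.of_forall fun x =>
      re_nonneg_of_sectorial (b := pairingForm (c.V x)) hM (hV x) _)).2
      (hfatou.trans_lt ENNReal.ofReal_lt_top)
  refine ⟨hmem, ?_⟩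
  rw [← ENNReal.ofReal_le_ofReal_iff hC0, ← lintegral_re_pairing_V hc ⟨f, hmem⟩]
  exact hfatou

/-- The form `a` is closed: the form domain is complete for the form norm. -/
theorem exists_tendsto_energy {u : ℕ → formDomain hc}
    (hu : ∀ ε > 0, ∃ N, ∀ m ≥ N, ∀ n ≥ N, energy hc (u m - u n) < ε) :
    ∃ v, Tendsto (fun n => energy hc (u n - v)) atTop (𝓝 0) := by
  obtain ⟨_, -, hpos⟩ := exists_abs_im_potentialForm_le hc
  have hnorm : ∀ w : formDomain hc, ‖(w : L2 d m)‖ ^ 2 ≤ energy hc w := fun w => by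
    have h1 := gradSq_nonneg hc w
    have h2 := (hpos w).1
    rw [energy]; linarith
  have hderiv : ∀ w k, ‖weakDerivₗ hc k w‖ ^ 2 ≤ energy hc w := fun w k => by
    have h1 := norm_weakDeriv_sq_le_gradSq hc w k
    have h2 := (hpos w).1
    have h3 := sq_nonneg ‖(w : L2 d m)‖
    rw [energy]; linarith
  have hpot : ∀ w, (potentialForm hc w w).re ≤ energy hc w := fun w => by
    have h1 := gradSq_nonneg hc w
    have h3 := sq_nonneg ‖(w : L2 d m)‖
    rw [energy]; linarith
  have hcauchy : ∀ T : formDomain hc →ₗ[ℂ] L2 d m, (∀ w, ‖T w‖ ^ 2 ≤ energy hc w) →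
      ∃ g, Tendsto (fun n => T (u n)) atTop (𝓝 g) := fun T hT => by
    refine cauchySeq_tendsto_of_complete (Metric.cauchySeq_iff.2 fun ε hε => ?_)
    obtain ⟨N, hN⟩ := hu (ε ^ 2) (by positivity)
    refine ⟨N, fun m hm n hn => ?_⟩
    rw [dist_eq_norm, ← map_sub]
    exact lt_of_pow_lt_pow_left₀ 2 hε.le ((hT _).trans_lt (hN m hm n hn))
  obtain ⟨f, hf⟩ := hcauchy (formDomain hc).subtype hnorm
  choose g hg using fun k => hcauchy (weakDerivₗ hc k) fun w => hderiv w k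
  have hfg : ∀ k, HasWeakDeriv k f (g k) := fun k =>
    HasWeakDeriv.of_tendsto (fun n => (u n).2.1.hasWeakDeriv k) hf (hg k)
  have hfH1 : MemH1 f := fun k => ⟨g k, hfg k⟩
  have hsub : ∀ n, MemH1 ((u n : L2 d m) - f) := fun n k => ⟨_, by
    have := ((u n).2.1.hasWeakDeriv k).add ((hfg k).smul (-1))
    rwa [neg_one_smul, ← sub_eq_add_neg] at this⟩
  have hlsc : ∀ ε > 0, ∃ N, ∀ n ≥ N, ∃ h : (u n : L2 d m) - f ∈ formDomain hc,
      (potentialForm hc ⟨_, h⟩ ⟨_, h⟩).re ≤ ε := fun ε hε => by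
    obtain ⟨N, hN⟩ := hu ε hε
    refine ⟨N, fun n hn => exists_mem_formDomain_of_tendsto hc (u := fun k => u n - u k) (hsub n)
      (hf.const_sub _) ?_⟩
    filter_upwards [eventually_ge_atTop N] with k hk
    exact (hpot _).trans (hN n hn k hk).le
  have hmem : f ∈ formDomain hc := by
    obtain ⟨N, hN⟩ := hlsc 1 one_pos
    have := (formDomain hc).sub_mem (u N).2 (hN N le_rfl).choose
    rwa [sub_sub_cancel] at this
  set v : formDomain hc := ⟨f, hmem⟩ with hv
  refine ⟨v, ?_⟩
  have h1 : Tendsto (fun n => ‖((u n - v : formDomain hc) : L2 d m)‖ ^ 2) atTop (𝓝 0) := by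
    have := ((tendsto_iff_norm_sub_tendsto_zero.1 hf).pow 2)
    simpa using this
  have h2 : Tendsto (fun n => gradSq hc (u n - v)) atTop (𝓝 0) := by
    have hk : ∀ k ∈ (Finset.univ : Finset (Fin d)),
        Tendsto (fun n => ‖weakDerivₗ hc k (u n - v)‖ ^ 2) atTop (𝓝 0) := fun k _ => by
      have hvk : weakDerivₗ hc k v = g k := (hfg k).weakDeriv_eq
      have := ((tendsto_iff_norm_sub_tendsto_zero.1 (hg k)).pow 2)
      simpa [hvk] using this
    simpa [gradSq] using tendsto_finsetSum _ hk
  have h3 : Tendsto (fun n => (potentialForm hc (u n - v) (u n - v)).re) atTop (𝓝 0) := by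
    rw [Metric.tendsto_atTop]
    intro ε hε
    obtain ⟨N, hN⟩ := hlsc (ε / 2) (by positivity)
    refine ⟨N, fun n hn => ?_⟩
    obtain ⟨h, hle⟩ := hN n hn
    have e : (⟨_, h⟩ : formDomain hc) = u n - v := rfl
    rw [e] at hle
    rw [Real.dist_eq, sub_zero, abs_of_nonneg (hpos _).1]
    linarith
  simpa [energy] using (h1.add h2).add h3

end Closedness

/-! ### The operator associated with the form -/

section Operator

variable {d m : ℕ} {c : Coefficients d m} (hc : Hypotheses c)

/-- The graph of the operator `κ - L` associated with the form `a + κ`. -/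
def shiftedGraph (κ : ℝ) : Submodule ℂ (L2 d m × L2 d m) where
  carrier := {p | ∃ hp : p.1 ∈ formDomain hc,
    ∀ h : formDomain hc, shiftedForm hc κ ⟨p.1, hp⟩ h = inner ℂ (h : L2 d m) p.2}
  add_mem' := by
    rintro p q ⟨hp, hpe⟩ ⟨hq, hqe⟩
    refine ⟨(formDomain hc).add_mem hp hq, fun h => ?_⟩
    rw [Prod.snd_add, inner_add_right, ← hpe, ← hqe, ← LinearMap.add_apply, ← map_add]
    rfl
  zero_mem' := ⟨(formDomain hc).zero_mem, fun h => by
    have e : (⟨(0 : L2 d m × L2 d m).1, (formDomain hc).zero_mem⟩ : formDomain hc) = 0 := rfl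
    rw [e, map_zero, LinearMap.zero_apply, Prod.snd_zero, inner_zero_right]⟩
  smul_mem' := by
    rintro a p ⟨hp, hpe⟩
    refine ⟨(formDomain hc).smul_mem a hp, fun h => ?_⟩
    rw [Prod.smul_snd, inner_smul_right, ← hpe, ← smul_eq_mul, ← LinearMap.smul_apply, ← map_smul]
    rfl

/-- Test functions lie in the form domain since `V` is locally integrable. -/
theorem memFormDomain_testLp {φ : Rd d → EuclideanSpace ℂ (Fin m)} (hφ : ContDiff ℝ ∞ φ)
    (hφc : HasCompactSupport φ) : testLp hφ.continuous hφc ∈ formDomain hc := by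
  refine (memFormDomain_iff hc).2 ⟨fun k => ⟨_, hasWeakDeriv_testLp hφ hφc k⟩, ?_⟩
  have hint : Integrable (fun x => pairing (c.V x) (φ x) (φ x)) volume := by
    simp only [pairing_eq_sum]
    refine integrable_finsetSum _ fun i _ => integrable_finsetSum _ fun j _ => ?_
    have hcont : Continuous fun x => φ x j * conj (φ x i) := by
      have := hφ.continuous
      fun_prop
    have hsupp : HasCompactSupport fun x => φ x j * conj (φ x i) := by
      refine hφc.mono fun x hx h0 => hx ?_
      simp [h0]
    have hV : LocallyIntegrable (fun x => (c.V x i j : ℂ)) volume := fun x => by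
      obtain ⟨U, hU, hint⟩ := hc.locallyIntegrable_V i j x
      exact ⟨U, hU, hint.ofReal⟩
    have := hV.integrable_smul_left_of_hasCompactSupport hcont hsupp
    simpa only [smul_eq_mul, mul_comm] using this
  refine hint.congr ?_
  filter_upwards [coeFn_testLp hφ.continuous hφc] with x hx
  rw [hx]

theorem shiftedGraph_snd_eq_zero (κ : ℝ) {p : L2 d m × L2 d m} (hp : p ∈ shiftedGraph hc κ)
    (h0 : p.1 = 0) : p.2 = 0 := by
  obtain ⟨hp1, hpe⟩ := hp
  refine eq_zero_of_forall_inner_testLp_eq_zero fun φ hφ hφc => ?_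
  rw [← hpe ⟨_, memFormDomain_testLp hc hφ hφc⟩]
  have e : (⟨p.1, hp1⟩ : formDomain hc) = 0 := Subtype.ext h0
  rw [e, map_zero, LinearMap.zero_apply]

theorem exists_isMSectorial_shiftedGraph :
    ∃ κ M : ℝ, 0 ≤ κ ∧ IsMSectorial (shiftedGraph hc κ) M := by
  obtain ⟨κ, M, α, β, hκ, hM, hα, hβ, hb⟩ := exists_shiftedForm_bounds hc
  refine ⟨κ, M, hκ, hM, ?_, fun p hp => shiftedGraph_snd_eq_zero hc κ hp, fun s hs y => ?_⟩
  · rintro p ⟨hp, hpe⟩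
    rw [← hpe ⟨p.1, hp⟩]
    exact (hb _).1
  · obtain ⟨u, hu⟩ := exists_forall_form_add_inner_eq (b := shiftedForm hc κ)
      (j := (formDomain hc).subtype) Subtype.val_injective hM (fun f => (hb f).1)
      (fun f => (hb f).2.1) (fun u hu => by
        obtain ⟨v, hv⟩ := exists_tendsto_energy hc (u := u) fun ε hε => by
          obtain ⟨N, hN⟩ := hu (α * ε) (by positivity)
          exact ⟨N, fun m hm n hn => lt_of_mul_lt_mul_left
            ((hb _).2.2.1.trans_lt (hN m hm n hn)) hα.le⟩
        refine ⟨v, squeeze_zero (fun n => (sq_nonneg _).trans (hb _).2.1)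
          (fun n => (hb _).2.2.2) ?_⟩
        simpa using hv.const_mul β) hs.le y
    refine ⟨((u : L2 d m), y - (s : ℂ) • (u : L2 d m)), ⟨u.2, fun h => ?_⟩, by simp⟩
    rw [inner_sub_right, inner_smul_right]
    exact eq_sub_of_add_eq (hu h)

include hc in
/-- The operator `L` with `-L` associated with the form `a`; it is single-valued because the form
domain is dense. -/
theorem exists_isFormRealization : ∃ L : L2 d m →ₗ.[ℂ] L2 d m, IsFormRealization c L := by
  let G : Submodule ℂ (L2 d m × L2 d m) := (shiftedGraph hc 0).map
    (LinearMap.prodMap LinearMap.id (-LinearMap.id))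
  have hgraph : ∀ p ∈ G, p.1 = 0 → p.2 = 0 := by
    rintro _ ⟨p, hp, rfl⟩ h0
    simp only [LinearMap.prodMap_apply, LinearMap.id_apply, LinearMap.neg_apply, neg_eq_zero]
      at h0 ⊢
    exact shiftedGraph_snd_eq_zero hc 0 hp h0
  refine ⟨G.toLinearPMap, fun f g => ?_⟩
  rw [Submodule.toLinearPMap_graph_eq _ hgraph]
  constructor
  · rintro ⟨p, ⟨hp, hpe⟩, hpfg⟩
    obtain ⟨rfl, rfl⟩ : p.1 = f ∧ -p.2 = g := Prod.mk.inj hpfg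
    refine ⟨hp, fun h hh => ?_⟩
    have := hpe ⟨h, hh⟩
    rw [shiftedForm_apply] at this
    simpa using this
  · rintro ⟨hf, hfe⟩
    refine ⟨(f, -g), ⟨hf, fun h => ?_⟩, by simp⟩
    rw [shiftedForm_apply, hfe h h.2]
    simp

theorem IsFormRealization.mem_graph_iff {L : L2 d m →ₗ.[ℂ] L2 d m} (hL : IsFormRealization c L)
    (κ : ℝ) (f g : L2 d m) :
    (f, g) ∈ L.graph ↔ (f, (κ : ℂ) • f - g) ∈ shiftedGraph hc κ := by
  rw [hL]
  constructor
  · rintro ⟨hf, hfe⟩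
    refine ⟨hf, fun h => ?_⟩
    rw [shiftedForm_apply, hfe h h.2, inner_sub_right, inner_smul_right]
    ring
  · rintro ⟨hf, hfe⟩
    refine ⟨hf, fun h hh => ?_⟩
    have := hfe ⟨h, hh⟩
    rw [shiftedForm_apply, inner_sub_right, inner_smul_right] at this
    linear_combination this

end Operator

/-! ### The differential expression in the sense of distributions -/

section Distributions

variable {d m : ℕ} {c : Coefficients d m} (hc : Hypotheses c)
include hc

/-- `V f` is locally integrable for `f` in the form domain: `(V f)_i = ⟨V f, e_i⟩` is controlled by
`⟨V_s f, f⟩` and `v_{ii}`. -/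
theorem locallyIntegrable_V_mul {f : L2 d m} (hf : MemFormDomain c f) (i : Fin m) :
    LocallyIntegrable (fun x => ∑ j, (c.V x i j : ℂ) * f x j) volume := by
  obtain ⟨M, hM, hV⟩ := hc.sectorial_V
  have hdom : LocallyIntegrable (fun x => (1 + M) * ((pairing (c.Vs x) (f x) (f x)).re
      + c.V x i i)) (volume : Measure (Rd d)) := by
    have h1 : LocallyIntegrable (fun x => (pairing (c.Vs x) (f x) (f x)).re)
      (volume : Measure (Rd d)) := hf.2.re.locallyIntegrable
    exact (h1.add (hc.locallyIntegrable_V i i)).smul (1 + M)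
  refine hdom.mono (Finset.aestronglyMeasurable_fun_sum _ fun j _ =>
    (aestronglyMeasurable_V hc i j).mul (memLp_component f j).1) (Eventually.of_forall fun x => ?_)
  have h1 := norm_le_of_sectorial (b := pairingForm (c.V x)) hM (hV x) (f x) (Pi.single i 1)
  have h2 : ∀ ξ : Fin m → ℂ, pairingForm (c.V x) ξ (Pi.single i 1)
      = ∑ j, (c.V x i j : ℂ) * ξ j := by
    intro ξ
    rw [pairingForm_apply, pairing, Finset.sum_eq_single i]
    · simp
    · intro k _ hk
      simp [hk]
    · simp
  have h3 : (pairingForm (c.V x) (Pi.single i 1) (Pi.single i 1)).re = c.V x i i := by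
    rw [h2]
    simp [Pi.single_apply]
  rw [h2, h3] at h1
  refine h1.trans (le_trans ?_ (le_abs_self _))
  rw [pairing_Vs, Complex.ofReal_re]
  rfl

theorem eqInDistributions_of_form_eq {f g : L2 d m} (hf : MemFormDomain c f)
    (hfe : ∀ h : L2 d m, MemFormDomain c h → form c f h = -inner ℂ h g) :
    EqInDistributions c f g := by
  refine ⟨hf.1, locallyIntegrable_V_mul hc hf, fun φ hφ hφc => ?_⟩
  have h1 := hfe _ (memFormDomain_testLp hc hφ hφc)
  have hφae := coeFn_testLp hφ.continuous hφc
  have hD : ∀ k, weakDeriv k (testLp hφ.continuous hφc)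
      =ᵐ[volume] fun x => fderiv ℝ φ x (unitVec k) := fun k => by
    rw [(hasWeakDeriv_testLp hφ hφc k).weakDeriv_eq]
    exact coeFn_testLp _ _
  have hDall : ∀ᵐ x, ∀ k, weakDeriv k (testLp hφ.continuous hφc) x
      = fderiv ℝ φ x (unitVec k) := ae_all_iff.2 hD
  have hform : form c f (testLp hφ.continuous hφc)
      = formIntegral c f (fun k => weakDeriv k f) φ (fun k x => fderiv ℝ φ x (unitVec k)) := by
    rw [form, formIntegral, formIntegral]
    congr 1
    · congr 1
      · congr 1
        · refine Finset.sum_congr rfl fun i _ => integral_congr_ae ?_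
          filter_upwards [hDall] with x hx
          simp only [hx]
        · refine Finset.sum_congr rfl fun i _ => Finset.sum_congr rfl fun j _ =>
            integral_congr_ae ?_
          filter_upwards [hφae] with x hx
          rw [hx]
      · refine Finset.sum_congr rfl fun i _ => Finset.sum_congr rfl fun j _ =>
          integral_congr_ae ?_
        filter_upwards [hDall] with x hx
        simp only [hx]
    · refine integral_congr_ae ?_
      filter_upwards [hφae] with x hx
      rw [hx]
  rw [← hform, h1, neg_neg, L2.inner_def]
  refine integral_congr_ae ?_
  filter_upwards [hφae] with x hx
  rw [hx, PiLp.inner_apply]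
  rfl

end Distributions

end EllipticSystem

end

theorem mainTheorem2 (d m : ℕ) (hd : 1 ≤ d) (hm : 1 ≤ m)
    (c : EllipticSystem.Coefficients d m) (hc : EllipticSystem.Hypotheses c) :
    ∃ L : EllipticSystem.L2 d m →ₗ.[ℂ] EllipticSystem.L2 d m,
      EllipticSystem.IsFormRealization c L ∧
      (∀ f : L.domain, EllipticSystem.EqInDistributions c f (L f)) ∧
      ∃ S : ℝ → EllipticSystem.L2 d m →L[ℂ] EllipticSystem.L2 d m,
        EllipticSystem.IsAnalyticC0Semigroup S ∧
        EllipticSystem.IsGenerator L S ∧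
        ∃ ω : ℝ, 0 ≤ ω ∧ ∀ t : ℝ, 0 ≤ t → ‖S t‖ ≤ Real.exp (ω * t) := by
  obtain ⟨L, hL⟩ := EllipticSystem.exists_isFormRealization hc
  obtain ⟨κ, M, hκ, hΓ⟩ := EllipticSystem.exists_isMSectorial_shiftedGraph hc
  obtain ⟨S, hS, hgen, hbound⟩ :=
    EllipticSystem.exists_isAnalyticC0Semigroup hΓ (hL.mem_graph_iff hc κ)
  refine ⟨L, hL, fun f => ?_, S, hS, hgen, κ, hκ, hbound⟩
  obtain ⟨hf, hfe⟩ := (hL f (L f)).1 (L.mem_graph f)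
  exact EllipticSystem.eqInDistributions_of_form_eq hc hf hfe
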